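/- **Setting.** There are $K\ge 2$ arms with reward laws $\nu_1,\dots,\nu_K$ and means $\bm P=(P_1,\dots,P_K)$. Let $\mathcal D$ be any class of probability laws on $\mathbb R$ that contains all Gaussian laws $N(m,1)$, $m\in\mathbb R$, and consists of atomless $1$-sub-Gaussian laws, i.e. $\mathbb E[e^{t(X-\mathbb E X)}]\le e^{t^2/2}$ for all $t\in\mathbb R$ (for example $\mathcal D=\{N(m,1):m\in\mathbb R\}$). For $\bm x\in\mathbb R^K$ let $i^*(\bm x)=\operatorname{argmax}_i x_i$ (a set). An algorithm with budget $T$ is a possibly randomized rule that selects the arm $I(t)$, $t\le T$, from the past arms and rewards (and an independent random seed), receives a reward of law $\nu_{I(t)}$, and after round $T$ recommends an arm $J(T)$; $\mathrm{PoE}_T(\nu)=\mathbb P(J(T)\notin i^*(\bm P))$. The risk measure is $H_1(\bm P)=\sum_{i\ne i^*(\bm P)}(\max_jP_j-P_i)^{-2}$, and the rate of a family $\mathcal A=(\mathcal A_T)_{T}$ of algorithms (which may depend on $T$) is $$R_{\mathcal A}=\inf_{\nu\in\mathcal D^K:\ |i^*(\bm P)|=1}H_1(\bm P)\,\liminf_{T\to\infty}\frac1T\log\frac1{\mathrm{PoE}_{\mathcal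 A_T}(\nu)}.$$ **Allocation.** For $\bm Q\in\mathbb R^K$ put $\Delta_i=\max_jQ_j-Q_i$. Let $D_i(\bm Q)=\Delta_i^2\sum_{j\ne i}(\Delta_j+\Delta_i)^{-2}$ for $i\notin i^*(\bm Q)$ and $D_i(\bm Q)=\min_{j\notin i^*(\bm Q)}D_j(\bm Q)$ for $i\in i^*(\bm Q)$; if all $Q_i$ are equal, $D_i(\bm Q)=1$ for all $i$. Let $w^\star_i(\bm Q)=\frac1{D_i(\bm Q)Z(\bm Q)}$ with $Z(\bm Q)=\sum_i1/D_i(\bm Q)$. **Almost Tracking** with parameters $C_{\mathrm{suf}}\in(0,1)$ and batch size $N$ pulls the arms in batches of $N$ rounds. Batch $1$ has weights $w_{1,i}=1/K$. For $b\ge2$ let $\bar{\bm Q}_{b-1}$ be the empirical means after the first $b-1$ batches, and let $\mathcal K_{\mathrm{insuf}}=\{i:\frac1{b-1}\sum_{b'<b}w_{b',i}\le\frac1{C_{\mathrm{suf}}}w^\star_i(\bar{\bm Q}_{b-1})\}$; then $w_{b,i}=w^\star_i(\bar{\bm Q}_{b-1})/\sum_{j\in\mathcal K_{\mathrm{insuf}}}w^\star_j(\bar{\bm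 Q}_{b-1})$ for $i\in\mathcal K_{\mathrm{insuf}}$ and $w_{b,i}=0$ otherwise. In batch $b$ arm $i$ is pulled $\lceil\!\lceil w_{b,i}N\rceil\!\rceil$ times, inside a batch in increasing order of the arms, where the rounding is as follows: with $N'=N-\#\{i:w_{b,i}>0\}$, arm $i$ first gets $1+\lfloor w_{b,i}N'\rfloor$ pulls if $w_{b,i}>0$ and none otherwise, and the pulls missing to a total of $N$ are given one by one to arms drawn independently with probabilities $w_{b,i}$. After $T$ rounds (the last batch may be incomplete) the arm with the largest empirical mean over all $T$ samples is recommended (ties go to the smallest index). **Theorem.** There are universal constants $C,c_1,c_2>0$ such that the following holds for every class $\mathcal D$ as above and every $K\ge2$. Every family $\mathcal A^*$ of algorithms satisfies $R_{\mathcal A^*}\le c_2/\log K$. Moreover, for every $C_{\mathrm{suf}}\in(0,1)$ and all batch sizes $N=N(T)$ with $N=\omega(K)$ and $T=\omega(NK\log K)$ as $T\to\infty$ (with $K$ fixed), Almost Tracking with the allocation $\bm w^\star$, parameter $C_{\mathrm{suf}}$ and batch size $N(T)$ is rate-optimal for $H_1$: its rate $R$ satisfies $$R\ \ge\ C\,R_{\mathcal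 A^*}\ \text{ for every family }\mathcal A^*\text{ of algorithms},\qquad\text{and}\qquad R\ \ge\ \frac{c_1}{\log K}.$$ In particular, the best possible rate is $\Theta(1/\log K)$ and Almost Tracking attains it up to a universal constant factor. -/

import Mathlib

open MeasureTheory ProbabilityTheory Filter Asymptotics

noncomputable section

namespace BAI

open Classical in
/-- The arms of maximal value, `i^*(x) = argmax_i x_i`, as a set (ties are possible). -/
def bestArms {K : ℕ} (x : Fin K → ℝ) : Finset (Fin K) :=
  Finset.univ.filter (fun i => ∀ j, x j ≤ x i)

/-- The gap `Δ_i = max_j x_j - x_i`. -/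
def gap {K : ℕ} (x : Fin K → ℝ) (i : Fin K) : ℝ := (⨆ j, x j) - x i

open Classical in
/-- The risk measure `H₁(P) = ∑_{i ≠ i^*(P)} (max_j P_j - P_i)^{-2}`. -/
def riskH1 {K : ℕ} (P : Fin K → ℝ) : ℝ :=
  ∑ i ∈ Finset.univ \ bestArms P, 1 / gap P i ^ 2

/-- A best arm identification algorithm with `K` arms and budget `T`. The internal randomness is a
random seed, independent of the rewards. At round `t` (counted from `0`) the sampling arm is chosen
from the seed and the history of (pulled arm, observed reward) of the previous `t` rounds; after `T`
rounds an arm is recommended from the seed and the whole history. -/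
structure Algorithm (K T : ℕ) where
  Seed : Type
  [seedSpace : MeasurableSpace Seed]
  seedLaw : Measure Seed
  [seedProb : IsProbabilityMeasure seedLaw]
  sample : (t : ℕ) → Seed × (Fin t → Fin K × ℝ) → Fin K
  measurable_sample : ∀ t, Measurable (sample t)
  recommend : Seed × (Fin T → Fin K × ℝ) → Fin K
  measurable_recommend : Measurable recommend

attribute [instance] Algorithm.seedSpace Algorithm.seedProb

/-- The joint law of the seed and of the history of the first `t` rounds when the reward law of arm
`i` is `ν i`: given the past, the reward of the next round has law `ν i`, where `i` is the arm
sampled in that round. -/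
def historyLaw {K T : ℕ} (A : Algorithm K T) (ν : Fin K → Measure ℝ) :
    (t : ℕ) → Measure (A.Seed × (Fin t → Fin K × ℝ))
  | 0 => A.seedLaw.map (fun s => (s, Fin.elim0))
  | t + 1 => (historyLaw A ν t).bind (fun p =>
      (ν (A.sample t p)).map (fun x =>
        (p.1, Fin.snoc (α := fun _ => Fin K × ℝ) p.2 (A.sample t p, x))))

/-- The vector of mean rewards of an instance. -/
def means {K : ℕ} (ν : Fin K → Measure ℝ) (i : Fin K) : ℝ := ∫ x, x ∂(ν i)

/-- The probability of error: the recommended arm is not the best arm. -/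
def probError {K T : ℕ} (A : Algorithm K T) (ν : Fin K → Measure ℝ) : ENNReal :=
  historyLaw A ν T {p | A.recommend p ∉ bestArms (means ν)}

/-- The rate of a family of algorithms (one for each budget `T`) for the risk measure `H`, when the
reward laws range over the class `D`: the infimum, over all instances with a unique best arm, of
`H(P) * liminf_{T → ∞} (1 / T) log (1 / PoE_T)`. An algorithm that does not use the budget is a
special case of such a family. -/
def rate {K : ℕ} (H : (Fin K → ℝ) → ℝ) (D : Set (Measure ℝ)) (A : (T : ℕ) → Algorithm K T) :
    EReal :=
  ⨅ (ν : Fin K → Measure ℝ) (_ : ∀ i, ν i ∈ D) (_ : (bestArms (means ν)).card = 1),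
    (H (means ν) : EReal) *
      liminf (fun T : ℕ => ENNReal.log (probError (A T) ν)⁻¹ / (T : EReal)) atTop

/-- The Gaussian laws of unit variance. -/
def gaussianLaws : Set (Measure ℝ) := {ν | ∃ m : ℝ, ν = gaussianReal m 1}

/-- The atomless `1`-sub-Gaussian laws, i.e. `E[exp (t (X - E X))] ≤ exp (t² / 2)` for all `t`. -/
def subGaussianLaws : Set (Measure ℝ) :=
  {ν | IsProbabilityMeasure ν ∧ (∀ x, ν {x} = 0) ∧ HasSubgaussianMGF (fun x => x - ∫ y, y ∂ν) 1 ν}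

/-! The allocation function. -/

open Classical in
/-- `H₁'(i, Q) = ∑_{j ≠ i} (Δ_j + Δ_i)^{-2}`. -/
def riskH1Alt {K : ℕ} (Q : Fin K → ℝ) (i : Fin K) : ℝ :=
  ∑ j ∈ Finset.univ.erase i, 1 / (gap Q j + gap Q i) ^ 2

open Classical in
/-- `D_i(Q)`: equal to `Δ_i² H₁'(i, Q)` if `i` is not a best arm of `Q`, and to the minimum of these
values for a best arm. If all entries of `Q` are equal this minimum is over the empty set, and
`D_i(Q) = 1` for all `i` (so that the allocation below is uniform). -/
def allocCost {K : ℕ} (Q : Fin K → ℝ) (i : Fin K) : ℝ :=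
  if h : (Finset.univ \ bestArms Q).Nonempty then
    if i ∈ bestArms Q then
      (Finset.univ \ bestArms Q).inf' h (fun j => gap Q j ^ 2 * riskH1Alt Q j)
    else gap Q i ^ 2 * riskH1Alt Q i
  else 1

/-- The allocation `w⋆_i(Q) = 1 / (D_i(Q) Z(Q))` with `Z(Q) = ∑_i 1 / D_i(Q)`. -/
def allocation {K : ℕ} (Q : Fin K → ℝ) (i : Fin K) : ℝ :=
  1 / (allocCost Q i * ∑ j, 1 / allocCost Q j)

/-! Almost Tracking. -/

open Classical in
/-- The first arm with property `p` (arm `0` if there is none). -/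
def firstArm {K : ℕ} [NeZero K] (p : Fin K → Prop) : Fin K :=
  if h : (Finset.univ.filter p).Nonempty then (Finset.univ.filter p).min' h else 0

/-- The arm drawn with probabilities `w` by a uniform variable `u` on `[0, 1]`. -/
def drawArm {K : ℕ} [NeZero K] (w : Fin K → ℝ) (u : unitInterval) : Fin K :=
  firstArm (fun i => 0 < w i ∧ (u : ℝ) ≤ ∑ j ∈ Finset.Iic i, w j)

open Classical in
/-- First part of the rounding of `w_i N`: with `N' = N - #{i : w_i > 0}`, arm `i` gets
`1 + ⌊w_i N'⌋` pulls if `w_i > 0` and none otherwise. -/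
def basePulls {K : ℕ} (N : ℕ) (w : Fin K → ℝ) (i : Fin K) : ℕ :=
  if 0 < w i then
    1 + ⌊w i * ((N : ℝ) - ((Finset.univ.filter (fun j => 0 < w j)).card : ℝ))⌋₊
  else 0

/-- The integer number of pulls: the pulls still missing to reach a total of `N` are given,
one by one, to arms drawn independently with probabilities `w`. -/
def roundedPulls {K : ℕ} [NeZero K] (N : ℕ) (w : Fin K → ℝ) (u : ℕ → unitInterval) (i : Fin K) :
    ℕ :=
  basePulls N w i +
    ∑ r ∈ Finset.range (N - ∑ j, basePulls N w j), if drawArm w (u r) = i then 1 else 0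

/-- The number of pulls of arm `i` during the first `m` rounds of a history. -/
def pulls {K t : ℕ} (h : Fin t → Fin K × ℝ) (m : ℕ) (i : Fin K) : ℕ :=
  ∑ s : Fin t, if (s : ℕ) < m ∧ (h s).1 = i then 1 else 0

/-- The empirical mean of arm `i` over the first `m` rounds of a history. -/
def empMean {K t : ℕ} (m : ℕ) (h : Fin t → Fin K × ℝ) (i : Fin K) : ℝ :=
  (∑ s : Fin t, if (s : ℕ) < m ∧ (h s).1 = i then (h s).2 else 0) / (pulls h m i : ℝ)

open Classical in
/-- The insufficiently drawn arms, where `b` batches are completed, `c i` is the sum of the weights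
of arm `i` in these batches, and `Q` is the vector of current empirical means. -/
def insufficient {K : ℕ} (w : (Fin K → ℝ) → Fin K → ℝ) (Csuf : ℝ) (b : ℕ) (c Q : Fin K → ℝ) :
    Finset (Fin K) :=
  Finset.univ.filter (fun i => 1 / (b : ℝ) * c i ≤ 1 / Csuf * w Q i)

open Classical in
/-- The weights of the next batch when `b` batches are completed: uniform in the first batch; later
proportional to `w_i(Q)` on the insufficiently drawn arms and zero elsewhere. -/
def nextWeights {K : ℕ} (w : (Fin K → ℝ) → Fin K → ℝ) (Csuf : ℝ) (b : ℕ) (c Q : Fin K → ℝ)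
    (i : Fin K) : ℝ :=
  if b = 0 then 1 / (K : ℝ)
  else if i ∈ insufficient w Csuf b c Q then
    w Q i / ∑ j ∈ insufficient w Csuf b c Q, w Q j
  else 0

/-- The sums of the weights over the first `b` batches, where `Q b` is the vector of empirical means
after `b` batches. -/
def cumWeights {K : ℕ} (w : (Fin K → ℝ) → Fin K → ℝ) (Csuf : ℝ) (Q : ℕ → Fin K → ℝ) :
    ℕ → Fin K → ℝ
  | 0 => fun _ => 0
  | b + 1 => fun i =>
      cumWeights w Csuf Q b i + nextWeights w Csuf b (cumWeights w Csuf Q b) (Q b) i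

/-- The weights of the batch that follows the first `b` batches. -/
def batchWeights {K : ℕ} (w : (Fin K → ℝ) → Fin K → ℝ) (Csuf : ℝ) (Q : ℕ → Fin K → ℝ) (b : ℕ) :
    Fin K → ℝ :=
  nextWeights w Csuf b (cumWeights w Csuf Q b) (Q b)

/-- The sampling arm at round `t` (counted from `0`) with `N` pulls per batch. This is round `t % N`
of the batch that follows the first `t / N` batches; inside a batch the arms are pulled in
increasing order. The number of pulls of each arm in a batch is fixed at the start of the batch, from
the empirical means of the completed batches and from the independent uniform variables
`s (b, 0), s (b, 1), …` of that batch. -/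
def trackingSample {K : ℕ} [NeZero K] (w : (Fin K → ℝ) → Fin K → ℝ) (Csuf : ℝ) (N : ℕ) (t : ℕ)
    (p : (ℕ × ℕ → unitInterval) × (Fin t → Fin K × ℝ)) : Fin K :=
  firstArm (fun i => t % N < ∑ j ∈ Finset.Iic i,
    roundedPulls N (batchWeights w Csuf (fun b => empMean (b * N) p.2) (t / N))
      (fun r => p.1 (t / N, r)) j)

/-- The recommended arm: the empirical best arm at the end (the first one in case of a tie). -/
def empiricalBest {K T : ℕ} [NeZero K] (h : Fin T → Fin K × ℝ) : Fin K :=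
  firstArm (fun i => i ∈ bestArms (empMean T h))

/-! Measurability. -/

section Measurability

variable {α : Type*} [MeasurableSpace α] {K : ℕ}

theorem measurable_of_finite_cover {β ι : Type*} [MeasurableSpace β] [Countable ι]
    [MeasurableSpace ι] [MeasurableSingletonClass ι] (S : α → ι) (hS : Measurable S)
    (F : ι → α → β) (hF : ∀ s, Measurable (F s)) : Measurable (fun a => F (S a) a) :=
  (measurable_from_prod_countable_right (f := fun p : ι × α => F p.1 p.2) hF).comp
    (hS.prodMk measurable_id)

open Classical in
theorem measurable_filter (p : Fin K → α → Prop) (hp : ∀ i, MeasurableSet {a | p i a}) :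
    Measurable (fun a => Finset.univ.filter (fun i => p i a)) := by
  refine measurable_to_countable' fun s => ?_
  have : (fun a => Finset.univ.filter (fun i => p i a)) ⁻¹' {s}
      = ⋂ i, if i ∈ s then {a | p i a} else {a | p i a}ᶜ := by
    ext a
    simp only [Set.mem_preimage, Set.mem_singleton_iff, Set.mem_iInter, Finset.ext_iff,
      Finset.mem_filter, Finset.mem_univ, true_and]
    refine forall_congr' fun i => ?_
    by_cases hi : i ∈ s <;> simp [hi]
  rw [this]
  refine MeasurableSet.iInter fun i => ?_
  split_ifs
  · exact hp i
  · exact (hp i).compl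

theorem measurable_firstArm [NeZero K] (p : Fin K → α → Prop)
    (hp : ∀ i, MeasurableSet {a | p i a}) : Measurable (fun a => firstArm (fun i => p i a)) := by
  classical
  unfold firstArm
  have := measurable_of_finite_cover (ι := Finset (Fin K)) _ (measurable_filter p hp)
    (fun s _ => if h : s.Nonempty then s.min' h else (0 : Fin K)) (fun s => measurable_const)
  convert this

theorem measurable_bestArms {f : α → Fin K → ℝ} (hf : Measurable f) :
    Measurable (fun a => bestArms (f a)) := by
  unfold bestArms
  convert measurable_filter (fun i a => ∀ j, f a j ≤ f a i) (fun i => ?_)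
  simp only [Set.ofPred_forall]
  exact MeasurableSet.iInter fun j => measurableSet_le (by fun_prop) (by fun_prop)

theorem measurable_gap (i : Fin K) : Measurable (fun Q : Fin K → ℝ => gap Q i) := by
  unfold gap
  exact (Measurable.iSup fun j => measurable_pi_apply j).sub (measurable_pi_apply i)

theorem measurable_riskH1Alt (i : Fin K) : Measurable (fun Q : Fin K → ℝ => riskH1Alt Q i) := by
  unfold riskH1Alt
  have := measurable_gap (K := K)
  fun_prop

theorem measurable_allocCost (i : Fin K) : Measurable (fun Q : Fin K → ℝ => allocCost Q i) := by
  classical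
  have hg := measurable_gap (K := K)
  have hr := measurable_riskH1Alt (K := K)
  have := measurable_of_finite_cover (ι := Finset (Fin K)) _
    (measurable_bestArms (f := fun Q : Fin K → ℝ => Q) measurable_id)
    (fun s Q => if h : (Finset.univ \ s).Nonempty then
      if i ∈ s then (Finset.univ \ s).inf' h (fun j => gap Q j ^ 2 * riskH1Alt Q j)
      else gap Q i ^ 2 * riskH1Alt Q i else 1) (fun s => ?_)
  · unfold allocCost
    convert this
  · by_cases h : (Finset.univ \ s).Nonempty
    · by_cases h' : i ∈ s
      · simp only [h, h', dite_true, if_true]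
        have := Finset.inf'_induction h (fun j (Q : Fin K → ℝ) => gap Q j ^ 2 * riskH1Alt Q j)
          (p := Measurable) (fun _ h₁ _ h₂ => h₁.inf h₂)
          (fun j _ => ((hg j).pow_const 2).mul (hr j))
        convert this using 1
        ext Q
        simp [Finset.inf'_apply]
      · simp only [h, h', dite_true, if_false]
        fun_prop
    · simp only [h, dite_false]
      fun_prop

theorem measurable_allocation : Measurable (allocation : (Fin K → ℝ) → Fin K → ℝ) := by
  refine measurable_pi_lambda _ fun i => ?_
  have := measurable_allocCost (K := K)
  unfold allocation
  fun_prop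

theorem measurable_drawArm [NeZero K] {f : α → Fin K → ℝ} (hf : Measurable f)
    {u : α → unitInterval} (hu : Measurable u) : Measurable (fun a => drawArm (f a) (u a)) := by
  unfold drawArm
  refine measurable_firstArm (fun i a => 0 < f a i ∧ ((u a : unitInterval) : ℝ) ≤
    ∑ j ∈ Finset.Iic i, f a j) fun i => ?_
  have h₁ : Measurable (fun a => f a i) := by fun_prop
  have h₂ : Measurable (fun a => ((u a : unitInterval) : ℝ)) := measurable_subtype_coe.comp hu
  have h₃ : Measurable (fun a => ∑ j ∈ Finset.Iic i, f a j) := by fun_prop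
  exact (measurableSet_lt measurable_const h₁).inter (measurableSet_le h₂ h₃)

theorem measurable_basePulls (N : ℕ) {f : α → Fin K → ℝ} (hf : Measurable f) (i : Fin K) :
    Measurable (fun a => basePulls N (f a) i) := by
  classical
  unfold basePulls
  have hc : Measurable (fun a => (Finset.univ.filter (fun j => 0 < f a j)).card) := by
    have := (Measurable.of_discrete (f := fun s : Finset (Fin K) => s.card)).comp
      (measurable_filter (fun j a => 0 < f a j)
        (fun i => measurableSet_lt measurable_const (by fun_prop)))
    simp only [Function.comp_def] at this
    convert this
  refine Measurable.ite (measurableSet_lt measurable_const (by fun_prop)) ?_ measurable_const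
  refine measurable_const.add (Nat.measurable_floor.comp ?_)
  refine Measurable.mul (by fun_prop) (measurable_const.sub ?_)
  exact (Measurable.of_discrete (f := fun n : ℕ => (n : ℝ))).comp hc

theorem measurable_roundedPulls [NeZero K] (N : ℕ) {f : α → Fin K → ℝ} (hf : Measurable f)
    {u : α → ℕ → unitInterval} (hu : Measurable u) (i : Fin K) :
    Measurable (fun a => roundedPulls N (f a) (u a) i) := by
  unfold roundedPulls
  have hb := measurable_basePulls N hf
  refine (hb i).add ?_
  refine measurable_of_finite_cover (fun a => N - ∑ j, basePulls N (f a) j) ?_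
    (fun n a => ∑ r ∈ Finset.range n, if drawArm (f a) (u a r) = i then 1 else 0) (fun n => ?_)
  · exact (measurable_from_top (f := fun n : ℕ => N - n)).comp
      (Finset.measurable_sum _ fun j _ => hb j)
  · refine Finset.measurable_sum _ fun r _ => ?_
    exact (measurable_from_top (f := fun j : Fin K => if j = i then 1 else 0)).comp
      (measurable_drawArm hf (by fun_prop))

theorem measurableSet_pull {t : ℕ} (m : ℕ) (s : Fin t) (i : Fin K) :
    MeasurableSet {h : Fin t → Fin K × ℝ | (s : ℕ) < m ∧ (h s).1 = i} := by
  refine MeasurableSet.inter (MeasurableSet.const _) ?_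
  exact (measurable_fst.comp (measurable_pi_apply s)) (measurableSet_singleton i)

theorem measurable_empMean {t : ℕ} (m : ℕ) :
    Measurable (empMean m : (Fin t → Fin K × ℝ) → Fin K → ℝ) := by
  refine measurable_pi_lambda _ fun i => ?_
  unfold empMean
  refine Measurable.div (Finset.measurable_sum _ fun s _ => ?_) ?_
  · exact Measurable.ite (measurableSet_pull m s i)
      (measurable_snd.comp (measurable_pi_apply s)) measurable_const
  · refine (measurable_from_top (f := fun n : ℕ => (n : ℝ))).comp ?_
    unfold pulls
    exact Finset.measurable_sum _ fun s _ =>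
      Measurable.ite (measurableSet_pull m s i) measurable_const measurable_const

theorem measurable_nextWeights {w : (Fin K → ℝ) → Fin K → ℝ} (hw : Measurable w) (Csuf : ℝ) (b : ℕ)
    {c Q : α → Fin K → ℝ} (hc : Measurable c) (hQ : Measurable Q) :
    Measurable (fun a => nextWeights w Csuf b (c a) (Q a)) := by
  classical
  refine measurable_pi_lambda _ fun i => ?_
  unfold nextWeights
  have hI : Measurable (fun a => insufficient w Csuf b (c a) (Q a)) := by
    unfold insufficient
    convert measurable_filter
      (fun i a => 1 / (b : ℝ) * c a i ≤ 1 / Csuf * w (Q a) i) (fun i => ?_)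
    exact measurableSet_le (by fun_prop) (by fun_prop)
  refine measurable_of_finite_cover (ι := Finset (Fin K)) _ hI
    (fun s a => if b = 0 then 1 / (K : ℝ) else if i ∈ s then w (Q a) i / ∑ j ∈ s, w (Q a) j else 0)
    (fun s => ?_)
  split_ifs <;> fun_prop

theorem measurable_cumWeights {w : (Fin K → ℝ) → Fin K → ℝ} (hw : Measurable w) (Csuf : ℝ)
    {Q : α → ℕ → Fin K → ℝ} (hQ : ∀ b, Measurable (fun a => Q a b)) (b : ℕ) :
    Measurable (fun a => cumWeights w Csuf (Q a) b) := by
  induction b with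
  | zero => exact measurable_const
  | succ b ih =>
    have h := measurable_nextWeights hw Csuf b ih (hQ b)
    refine measurable_pi_lambda _ fun i => ?_
    exact ((measurable_pi_apply i).comp ih).add ((measurable_pi_apply i).comp h)

theorem measurable_trackingSample [NeZero K] {w : (Fin K → ℝ) → Fin K → ℝ} (hw : Measurable w)
    (Csuf : ℝ) (N t : ℕ) : Measurable (trackingSample w Csuf N t) := by
  unfold trackingSample
  refine measurable_firstArm (fun i (p : (ℕ × ℕ → unitInterval) × (Fin t → Fin K × ℝ)) =>
    t % N < ∑ j ∈ Finset.Iic i,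
      roundedPulls N (batchWeights w Csuf (fun b => empMean (b * N) p.2) (t / N))
      (fun r => p.1 (t / N, r)) j) fun i => ?_
  refine measurableSet_lt measurable_const (Finset.measurable_sum _ fun j _ => ?_)
  have hQ : ∀ b, Measurable (fun p : (ℕ × ℕ → unitInterval) × (Fin t → Fin K × ℝ) =>
      empMean (b * N) p.2) := fun b => (measurable_empMean _).comp measurable_snd
  refine measurable_roundedPulls N ?_ (by fun_prop) j
  exact measurable_nextWeights hw Csuf _ (measurable_cumWeights hw Csuf hQ _) (hQ _)

theorem measurable_empiricalBest [NeZero K] {T : ℕ} :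
    Measurable (empiricalBest : (Fin T → Fin K × ℝ) → Fin K) := by
  unfold empiricalBest
  refine measurable_firstArm (fun i h => i ∈ bestArms (empMean T h)) fun i => ?_
  exact (measurable_bestArms (measurable_empMean T)) (MeasurableSet.of_discrete (s := {s | i ∈ s}))

end Measurability

/-- Almost Tracking with the target allocation function `w`, parameter `Csuf` and `N` draws per
batch, stopped after `T` rounds. -/
def almostTracking {K : ℕ} [NeZero K] (w : (Fin K → ℝ) → Fin K → ℝ) (hw : Measurable w)
    (Csuf : ℝ) (N T : ℕ) : Algorithm K T where
  Seed := ℕ × ℕ → unitInterval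
  seedLaw := Measure.infinitePi (fun _ => (volume : Measure unitInterval))
  sample := trackingSample w Csuf N
  measurable_sample := measurable_trackingSample hw Csuf N
  recommend := fun p => empiricalBest p.2
  measurable_recommend := measurable_empiricalBest.comp measurable_snd

end BAI

end

/-! The two halves are independent: an upper bound `32 / log K` valid for every family (`rate_le`),
and a lower bound `1 / (196608 log K)` for Almost Tracking (`le_rate_almostTracking`). The
comparison constant `C` is their ratio.

Upper bound. Take Gaussian means `0, -1, -2, …`, and for each arm `i` the instance in which its mean
is flipped to `i`. In the base instance the `T` pulls cannot exceed the share `T (1/i) / ∑ 1/j` for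
every `i ≠ 0`, and `∑ 1/j ≥ log K`. Some arm `i` is therefore pulled on average at most about `T /
(i log K)` times. Flipping it moves its mean by `2i`, so the two instances differ by information of
order `i² · T / (i log K)`. A second-moment change of measure (`eight_mul_measure_le`) turns this
into an error probability of at least `exp(-16 i T / log K) / 64`. The flipped instance has `H₁ ≤ 2
/ i`, so the factor `i` cancels and the logarithm remains.

Lower bound, probabilistic part. For each batch and arm let `S` be the centered reward sum and `n`
the number of pulls. The total deviation is the sum of `S² / (2(n+1))`. Gaussian mixtures of
exponential supermartingales, multiplied over batches and arms, give `P(deviation ≥ x) ≤ (N+1)^(BK)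
e^(-x)` for `B` batches (`measure_deviation_ge_le`). There are about `T/N` batches and `N → ∞`, so
the prefactor is `exp(o(T))`. It then suffices to show, path by path, that an error forces a
deviation of order `T / (H₁ log K)` (`le_deviation_of_error`).

Lower bound, deterministic part. The key is `deviation_or_allocation`, for a vector `Q` of empirical
means and true means `P`. Either some arm has a large `w⋆_k(Q) (Q_k - P_k)²`, or `w⋆(Q)` already
gives each suboptimal arm `j`, and the best arm, enough weight to resolve the gap of `j` in `P`. The
factor `log K` enters through `Z = ∑ 1/D_i = O(log K)`. Over the batches there are three cases
(`le_total_deviation`). A deviating arm with sufficient past pulls gives a large deviation at once.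
Many batches that spend pulls on a deviating arm also give one, because a Hardy-type inequality
bounds `∑ n_b (Q_{b,k} - P_k)²` by the total deviation. Otherwise many batches used an allocation
good for `P`, and the final error must overcome half a gap on a well-sampled arm. -/

namespace BAI

/-! ### The law of the history -/

section HistoryLaw

variable {K T : ℕ} (A : Algorithm K T) (ν : Fin K → Measure ℝ)

/-- The history after one more round. -/
def extend (t : ℕ) (p : A.Seed × (Fin t → Fin K × ℝ)) (x : ℝ) :
    A.Seed × (Fin (t + 1) → Fin K × ℝ) :=
  (p.1, Fin.snoc (α := fun _ => Fin K × ℝ) p.2 (A.sample t p, x))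

theorem measurable_snoc {α β : Type*} [MeasurableSpace α] [MeasurableSpace β] (t : ℕ)
    {f : α → Fin t → β} {g : α → β} (hf : Measurable f) (hg : Measurable g) :
    Measurable (fun a => Fin.snoc (α := fun _ => β) (f a) (g a)) := by
  refine measurable_pi_lambda _ fun i => ?_
  refine Fin.lastCases ?_ (fun j => ?_) i
  · simpa using hg
  · simpa [Function.comp_def] using (measurable_pi_apply j).comp hf

theorem measurable_extend (t : ℕ) :
    Measurable (fun q : (A.Seed × (Fin t → Fin K × ℝ)) × ℝ => extend A t q.1 q.2) := by
  unfold extend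
  have h := A.measurable_sample t
  exact (by fun_prop : Measurable
    fun q : (A.Seed × (Fin t → Fin K × ℝ)) × ℝ => q.1.1).prodMk
    (measurable_snoc t (by fun_prop) (by fun_prop))

variable [∀ i, IsProbabilityMeasure (ν i)]

theorem measurable_lintegral_sample (t : ℕ)
    {f : (A.Seed × (Fin t → Fin K × ℝ)) × ℝ → ENNReal} (hf : Measurable f) :
    Measurable (fun p => ∫⁻ x, f (p, x) ∂ν (A.sample t p)) :=
  measurable_of_finite_cover (A.sample t) (A.measurable_sample t)
    (fun i p => ∫⁻ x, f (p, x) ∂ν i) (fun _ => hf.lintegral_prod_right')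

theorem measurable_stepLaw (t : ℕ) :
    Measurable (fun p => (ν (A.sample t p)).map (extend A t p)) := by
  refine Measure.measurable_of_measurable_coe _ fun s hs => ?_
  have h := measurable_lintegral_sample A ν t
    (f := fun q => s.indicator 1 (extend A t q.1 q.2))
    ((measurable_one.indicator hs).comp (measurable_extend A t))
  convert h with p
  have hm : Measurable (extend A t p) := (measurable_extend A t).comp measurable_prodMk_left
  rw [Measure.map_apply hm hs, ← lintegral_indicator_one (hm hs)]
  rfl

theorem lintegral_historyLaw_succ (t : ℕ) {f : A.Seed × (Fin (t + 1) → Fin K × ℝ) → ENNReal}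
    (hf : Measurable f) :
    ∫⁻ q, f q ∂historyLaw A ν (t + 1) =
      ∫⁻ p, ∫⁻ x, f (extend A t p x) ∂ν (A.sample t p) ∂historyLaw A ν t := by
  refine (Measure.lintegral_bind (measurable_stepLaw A ν t).aemeasurable hf.aemeasurable).trans ?_
  refine lintegral_congr fun p => ?_
  exact lintegral_map hf ((measurable_extend A t).comp measurable_prodMk_left)

theorem isProbabilityMeasure_historyLaw (t : ℕ) : IsProbabilityMeasure (historyLaw A ν t) := by
  induction t with
  | zero =>
    exact Measure.isProbabilityMeasure_map (measurable_id.prodMk measurable_const).aemeasurable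
  | succ t ih =>
    refine ⟨?_⟩
    rw [← lintegral_one, lintegral_historyLaw_succ A ν t measurable_const]
    simp

theorem ae_historyLaw_succ (t : ℕ) {S : Set (A.Seed × (Fin (t + 1) → Fin K × ℝ))}
    (hS : MeasurableSet S)
    (h : ∀ᵐ p ∂historyLaw A ν t, ∀ᵐ x ∂ν (A.sample t p), extend A t p x ∈ S) :
    ∀ᵐ q ∂historyLaw A ν (t + 1), q ∈ S := by
  rw [ae_iff]
  change historyLaw A ν (t + 1) Sᶜ = 0
  rw [← lintegral_indicator_one hS.compl,
    lintegral_historyLaw_succ A ν t (measurable_one.indicator hS.compl)]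
  rw [lintegral_eq_zero_iff (measurable_lintegral_sample A ν t
    (f := fun q => Sᶜ.indicator 1 (extend A t q.1 q.2))
    ((measurable_one.indicator hS.compl).comp (measurable_extend A t)))]
  filter_upwards [h] with p hp
  change ∫⁻ x, Sᶜ.indicator 1 (extend A t p x) ∂ν (A.sample t p) = 0
  rw [← lintegral_zero (μ := ν (A.sample t p))]
  refine lintegral_congr_ae ?_
  filter_upwards [hp] with x hx
  simp [hx]

/-- The history truncated to the first `s` rounds. -/
def truncate {t : ℕ} (h : Fin t → Fin K × ℝ) (s : ℕ) (hs : s ≤ t) : Fin s → Fin K × ℝ :=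
  fun r => h (Fin.castLE hs r)

/-- Almost surely the recorded arms are those chosen by the sampling rule. -/
theorem ae_sampled (t : ℕ) :
    ∀ᵐ p ∂historyLaw A ν t, ∀ s : Fin t,
      (p.2 s).1 = A.sample s (p.1, truncate p.2 s s.2.le) := by
  induction t with
  | zero => exact ae_of_all _ fun p s => s.elim0
  | succ t ih =>
    have hm : MeasurableSet {q : A.Seed × (Fin (t + 1) → Fin K × ℝ) | ∀ s : Fin (t + 1),
        (q.2 s).1 = A.sample s (q.1, truncate q.2 s s.2.le)} := by
      rw [Set.ofPred_forall]
      refine MeasurableSet.iInter fun s => ?_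
      refine measurableSet_eq_fun (by fun_prop) ((A.measurable_sample s).comp ?_)
      refine measurable_fst.prodMk ?_
      unfold truncate
      fun_prop
    refine ae_historyLaw_succ A ν t hm ?_
    filter_upwards [ih] with p hp
    refine ae_of_all _ fun x s => ?_
    refine Fin.lastCases ?_ (fun j => ?_) s
    · have : truncate (extend A t p x).2 t (Nat.le_succ t) = p.2 := by
        funext r
        have : Fin.castLE (Nat.le_succ t) r = r.castSucc := rfl
        simp only [truncate, extend, this, Fin.snoc_castSucc]
      have h2 : ((extend A t p x).2 (Fin.last t)).1 = A.sample t p := by simp [extend]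
      rw [h2]
      change _ = A.sample t ((extend A t p x).1, truncate (extend A t p x).2 t (Nat.le_succ t))
      rw [this]
      rfl
    · have : truncate (extend A t p x).2 j (j.2.le.trans (Nat.le_succ t))
          = truncate p.2 j j.2.le := by
        funext r
        have : Fin.castLE (j.2.le.trans (Nat.le_succ t)) r = (Fin.castLE j.2.le r).castSucc := rfl
        simp only [truncate, extend, this, Fin.snoc_castSucc]
      have h2 : ((extend A t p x).2 j.castSucc).1 = (p.2 j).1 := by simp [extend]
      rw [h2, hp j]
      change _ = A.sample j ((extend A t p x).1,
        truncate (extend A t p x).2 j (j.2.le.trans (Nat.le_succ t)))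
      rw [this]
      rfl

end HistoryLaw

/-! ### Absence of ties -/

section Ties

variable {K : ℕ}

/-- The sum of the rewards of arm `i` over the first `m` rounds of a history. -/
def rewardSum {t : ℕ} (h : Fin t → Fin K × ℝ) (m : ℕ) (i : Fin K) : ℝ :=
  ∑ s : Fin t, if (s : ℕ) < m ∧ (h s).1 = i then (h s).2 else 0

theorem pulls_snoc {t : ℕ} (h : Fin t → Fin K × ℝ) (a : Fin K) (x : ℝ) (m : ℕ) (i : Fin K) :
    pulls (Fin.snoc (α := fun _ => Fin K × ℝ) h (a, x)) m i =
      pulls h m i + if t < m ∧ a = i then 1 else 0 := by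
  simp [pulls, Fin.sum_univ_castSucc, -Finset.sum_boole]

theorem rewardSum_snoc {t : ℕ} (h : Fin t → Fin K × ℝ) (a : Fin K) (x : ℝ) (m : ℕ) (i : Fin K) :
    rewardSum (Fin.snoc (α := fun _ => Fin K × ℝ) h (a, x)) m i =
      rewardSum h m i + if t < m ∧ a = i then x else 0 := by
  simp [rewardSum, Fin.sum_univ_castSucc]

theorem measurable_pulls {t : ℕ} (m : ℕ) (i : Fin K) :
    Measurable (fun h : Fin t → Fin K × ℝ => pulls h m i) := by
  unfold pulls
  exact Finset.measurable_sum _ fun s _ =>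
    Measurable.ite (measurableSet_pull m s i) measurable_const measurable_const

theorem ae_ne_of_atomless {ν : Measure ℝ} (hν : ∀ x, ν {x} = 0) (c : ℝ) : ∀ᵐ x ∂ν, x ≠ c := by
  rw [ae_iff]
  simpa using hν c

/-- Given the past, a new reward of one of the two arms creates a tie only if it hits a single value
determined by the past, which an atomless law avoids. Both pull counts must be positive because the
mean of an unpulled arm is `0 / 0 = 0`. This is what makes the empirical best arm unique, as the
allocation lemmas require. -/
theorem ae_empMean_ne {T : ℕ} (A : Algorithm K T) (ν : Fin K → Measure ℝ)
    [∀ i, IsProbabilityMeasure (ν i)] (hν : ∀ i x, ν i {x} = 0) (m : ℕ) {i j : Fin K} (hij : i ≠ j)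
    (t : ℕ) :
    ∀ᵐ p ∂historyLaw A ν t, 0 < pulls p.2 m i → 0 < pulls p.2 m j →
      empMean m p.2 i ≠ empMean m p.2 j := by
  have step : ∀ (n k : ℕ) (u v x : ℝ), 0 < k →
      (u + x) / ((n + 1 : ℕ) : ℝ) = v / k → x = v / k * (n + 1) - u := by
    intro n k u v x hk h
    have : ((n + 1 : ℕ) : ℝ) ≠ 0 := by positivity
    rw [div_eq_iff this] at h
    push_cast at h
    linarith
  induction t with
  | zero => exact ae_of_all _ fun p hi => by simp [pulls] at hi
  | succ t ih =>
    have hm : MeasurableSet {q : A.Seed × (Fin (t + 1) → Fin K × ℝ) | 0 < pulls q.2 m i →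
        0 < pulls q.2 m j → empMean m q.2 i ≠ empMean m q.2 j} := by
      have hsnd : Measurable (Prod.snd : A.Seed × (Fin (t + 1) → Fin K × ℝ) → _) := measurable_snd
      have h1 := (measurable_pulls (K := K) (t := t + 1) m i).comp hsnd
      have h2 := (measurable_pulls (K := K) (t := t + 1) m j).comp hsnd
      have h3 := (measurable_empMean (K := K) (t := t + 1) m).comp hsnd
      refine (measurableSet_lt measurable_const h1).imp
        ((measurableSet_lt measurable_const h2).imp ?_)
      exact (measurableSet_eq_fun ((measurable_pi_apply i).comp h3)
        ((measurable_pi_apply j).comp h3)).compl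
    refine ae_historyLaw_succ A ν t hm ?_
    filter_upwards [ih] with p hp
    by_cases htm : t < m
    · have hgen : ∀ k l : Fin K, k ≠ l → A.sample t p = k →
          ∀ᵐ x ∂ν (A.sample t p), 0 < pulls (extend A t p x).2 m l →
            empMean m (extend A t p x).2 k ≠ empMean m (extend A t p x).2 l := by
        intro k l hkl ha
        filter_upwards [ae_ne_of_atomless (hν (A.sample t p))
          (rewardSum p.2 m l / pulls p.2 m l * (pulls p.2 m k + 1) - rewardSum p.2 m k)]
          with x hx hl heq
        refine hx ?_
        have e1 : empMean m (extend A t p x).2 k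
            = rewardSum (extend A t p x).2 m k / pulls (extend A t p x).2 m k := rfl
        have e2 : empMean m (extend A t p x).2 l
            = rewardSum (extend A t p x).2 m l / pulls (extend A t p x).2 m l := rfl
        rw [e1, e2] at heq
        simp only [extend, pulls_snoc, rewardSum_snoc, htm, ha, hkl, true_and, if_true, if_false,
          add_zero] at heq hl
        exact step _ _ _ _ _ hl heq
      by_cases hai : A.sample t p = i
      · filter_upwards [hgen i j hij hai] with x hx _ hj using hx hj
      by_cases haj : A.sample t p = j
      · filter_upwards [hgen j i hij.symm haj] with x hx hi _ using (hx hi).symm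
      refine ae_of_all _ fun x => ?_
      change 0 < pulls (extend A t p x).2 m i → 0 < pulls (extend A t p x).2 m j →
        rewardSum (extend A t p x).2 m i / pulls (extend A t p x).2 m i
          ≠ rewardSum (extend A t p x).2 m j / pulls (extend A t p x).2 m j
      simp only [extend, pulls_snoc, rewardSum_snoc, hai, haj, and_false, if_false, add_zero]
      exact hp
    · refine ae_of_all _ fun x => ?_
      change 0 < pulls (extend A t p x).2 m i → 0 < pulls (extend A t p x).2 m j →
        rewardSum (extend A t p x).2 m i / pulls (extend A t p x).2 m i
          ≠ rewardSum (extend A t p x).2 m j / pulls (extend A t p x).2 m j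
      simp only [extend, pulls_snoc, rewardSum_snoc, htm, false_and, if_false, add_zero]
      exact hp

end Ties

/-! ### Self-normalized concentration -/

section Concentration

variable {K : ℕ}

/-- The Gaussian mixture of the exponential martingales of a sum `S` of `m` centered terms. -/
noncomputable def mixture (S : ℝ) (m : ℕ) : ℝ :=
  Real.exp (S ^ 2 / (2 * (m + 1))) / √(m + 1)

theorem mixture_pos (S : ℝ) (m : ℕ) : 0 < mixture S m := by unfold mixture; positivity

theorem lintegral_exp_mul_gaussianReal (S : ℝ) (v : NNReal) :
    ∫⁻ g, ENNReal.ofReal (Real.exp (g * S)) ∂gaussianReal 0 v =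
      ENNReal.ofReal (Real.exp (v * S ^ 2 / 2)) := by
  have h := congrFun (mgf_id_gaussianReal (μ := 0) (v := v)) S
  simp only [mgf, id, zero_mul, zero_add] at h
  rw [← h, ofReal_integral_eq_lintegral_ofReal]
  · simp_rw [mul_comm S]
  · exact integrable_exp_mul_gaussianReal S
  · exact ae_of_all _ fun _ => (Real.exp_pos _).le

theorem gaussianPDFReal_mul_exp (m : ℕ) (g : ℝ) :
    gaussianPDFReal 0 (1 / (m + 2)) g * Real.exp (g ^ 2 / 2) =
      √(m + 2) / √(m + 1) * gaussianPDFReal 0 (1 / (m + 1)) g := by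
  have h1 : (0 : ℝ) < m + 1 := by positivity
  have h2 : (0 : ℝ) < m + 2 := by positivity
  simp only [gaussianPDFReal, NNReal.coe_div, NNReal.coe_one, NNReal.coe_add, NNReal.coe_natCast,
    NNReal.coe_ofNat, sub_zero]
  have e1 : √(2 * Real.pi * (1 / ((m : ℝ) + 2))) = √(2 * Real.pi) / √(m + 2) := by
    rw [mul_one_div, Real.sqrt_div (by positivity)]
  have e2 : √(2 * Real.pi * (1 / ((m : ℝ) + 1))) = √(2 * Real.pi) / √(m + 1) := by
    rw [mul_one_div, Real.sqrt_div (by positivity)]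
  rw [e1, e2, mul_assoc, ← Real.exp_add]
  have e3 : -g ^ 2 / (2 * (1 / ((m : ℝ) + 2))) + g ^ 2 / 2 = -g ^ 2 / (2 * (1 / ((m : ℝ) + 1))) := by
    field_simp
    ring
  rw [e3]
  have : √((m : ℝ) + 1) ≠ 0 := by positivity
  have : √((m : ℝ) + 2) ≠ 0 := by positivity
  have : √(2 * Real.pi) ≠ 0 := by positivity
  field_simp

/-- The factor `exp(g²/2)` lowers the precision of the Gaussian from `m + 2` to `m + 1`, up to
normalization. What remains is an ordinary Gaussian moment generating function. -/
theorem lintegral_exp_sq_gaussianReal (S : ℝ) (m : ℕ) :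
    ∫⁻ g, ENNReal.ofReal (Real.exp (g * S + g ^ 2 / 2)) ∂gaussianReal 0 (1 / (m + 2)) =
      ENNReal.ofReal (√(m + 2) * mixture S m) := by
  have hv2 : (1 / ((m : NNReal) + 2)) ≠ 0 := by positivity
  have hv1 : (1 / ((m : NNReal) + 1)) ≠ 0 := by positivity
  have key : ∀ g, gaussianPDF 0 (1 / (m + 2)) g * ENNReal.ofReal (Real.exp (g * S + g ^ 2 / 2)) =
      ENNReal.ofReal (√(m + 2) / √(m + 1)) *
        (gaussianPDF 0 (1 / (m + 1)) g * ENNReal.ofReal (Real.exp (g * S))) := by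
    intro g
    unfold gaussianPDF
    rw [← ENNReal.ofReal_mul (gaussianPDFReal_nonneg _ _ _),
      ← ENNReal.ofReal_mul (gaussianPDFReal_nonneg _ _ _), ← ENNReal.ofReal_mul (by positivity)]
    congr 1
    rw [← mul_assoc, ← gaussianPDFReal_mul_exp, mul_assoc, ← Real.exp_add,
      add_comm (g * S)]
  have h := lintegral_exp_mul_gaussianReal S (1 / (m + 1))
  rw [gaussianReal_of_var_ne_zero _ hv1, lintegral_withDensity_eq_lintegral_mul _
    (measurable_gaussianPDF _ _) (by fun_prop)] at h
  rw [gaussianReal_of_var_ne_zero _ hv2, lintegral_withDensity_eq_lintegral_mul _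
    (measurable_gaussianPDF _ _) (by fun_prop)]
  simp only [Pi.mul_apply] at h ⊢
  rw [lintegral_congr key, lintegral_const_mul _ (by fun_prop), h,
    ← ENNReal.ofReal_mul (by positivity)]
  congr 1
  unfold mixture
  have : ((1 / ((m : NNReal) + 1) : NNReal) : ℝ) * S ^ 2 / 2 = S ^ 2 / (2 * (m + 1)) := by
    push_cast
    field_simp
  rw [this]
  ring

/-- The one-step supermartingale property. The mixture after `m + 1` terms is an average of `exp(g(S
+ x))` over `g` of variance `1/(m+2)`. Exchanging the integrals, sub-Gaussianity bounds the average
over the reward by `exp(gS + g²/2)`, and integrating over `g` returns the mixture after `m` terms.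
-/
theorem lintegral_mixture_le {ν : Measure ℝ} (hν : ν ∈ subGaussianLaws) (S : ℝ) (m : ℕ) :
    ∫⁻ x, ENNReal.ofReal (mixture (S + (x - ∫ y, y ∂ν)) (m + 1)) ∂ν ≤
      ENNReal.ofReal (mixture S m) := by
  obtain ⟨hprob, -, hsub⟩ := hν
  set μ := ∫ y, y ∂ν
  set γ := gaussianReal 0 (1 / ((m : NNReal) + 2))
  have hs : (0 : ℝ) < √(m + 2) := by positivity
  have e : ∀ x, ENNReal.ofReal (mixture (S + (x - μ)) (m + 1)) =
      ENNReal.ofReal (1 / √(m + 2)) *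
        ∫⁻ g, ENNReal.ofReal (Real.exp (g * (S + (x - μ)))) ∂γ := by
    intro x
    rw [lintegral_exp_mul_gaussianReal, ← ENNReal.ofReal_mul (by positivity)]
    congr 1
    unfold mixture
    push_cast
    have h2 : ((m : ℝ) + 1 + 1) = m + 2 := by ring
    rw [h2]
    have h3 : 1 / ((m : ℝ) + 2) * (S + (x - μ)) ^ 2 / 2 = (S + (x - μ)) ^ 2 / (2 * (m + 2)) := by
      field_simp
    rw [h3]
    ring
  have hmeas : Measurable (fun q : ℝ × ℝ => ENNReal.ofReal (Real.exp (q.2 * (S + (q.1 - μ))))) := by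
    fun_prop
  simp_rw [e]
  rw [lintegral_const_mul _ hmeas.lintegral_prod_right', lintegral_lintegral_swap hmeas.aemeasurable]
  have hin : ∀ g, ∫⁻ x, ENNReal.ofReal (Real.exp (g * (S + (x - μ)))) ∂ν ≤
      ENNReal.ofReal (Real.exp (g * S + g ^ 2 / 2)) := by
    intro g
    have h1 := hsub.mgf_le g
    simp only [mgf, NNReal.coe_one, one_mul] at h1
    calc ∫⁻ x, ENNReal.ofReal (Real.exp (g * (S + (x - μ)))) ∂ν
        = ENNReal.ofReal (Real.exp (g * S)) *
            ∫⁻ x, ENNReal.ofReal (Real.exp (g * (x - μ))) ∂ν := by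
          rw [← lintegral_const_mul _ (by fun_prop)]
          refine lintegral_congr fun x => ?_
          rw [← ENNReal.ofReal_mul (by positivity), ← Real.exp_add]
          ring_nf
      _ = ENNReal.ofReal (Real.exp (g * S)) *
            ENNReal.ofReal (∫ x, Real.exp (g * (x - μ)) ∂ν) := by
          rw [ofReal_integral_eq_lintegral_ofReal (hsub.integrable_exp_mul g)
            (ae_of_all _ fun _ => (Real.exp_pos _).le)]
      _ ≤ ENNReal.ofReal (Real.exp (g * S)) * ENNReal.ofReal (Real.exp (g ^ 2 / 2)) := by
          gcongr
      _ = _ := by rw [← ENNReal.ofReal_mul (by positivity), ← Real.exp_add]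
  refine (mul_le_mul_right (lintegral_mono hin) _).trans ?_
  rw [lintegral_exp_sq_gaussianReal, ← ENNReal.ofReal_mul (by positivity)]
  refine le_of_eq (congrArg _ ?_)
  field_simp

/-- The number of pulls of arm `i` in batch `b` (counted from `0`). -/
def batchPulls {t : ℕ} (N : ℕ) (h : Fin t → Fin K × ℝ) (b : ℕ) (i : Fin K) : ℕ :=
  ∑ s : Fin t, if (s : ℕ) / N = b ∧ (h s).1 = i then 1 else 0

/-- The sum of the rewards of arm `i` in batch `b`, centered at `P i`. -/
def batchDev {t : ℕ} (N : ℕ) (P : Fin K → ℝ) (h : Fin t → Fin K × ℝ) (b : ℕ) (i : Fin K) : ℝ :=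
  ∑ s : Fin t, if (s : ℕ) / N = b ∧ (h s).1 = i then (h s).2 - P i else 0

theorem batchPulls_snoc {t : ℕ} (N : ℕ) (h : Fin t → Fin K × ℝ) (a : Fin K) (x : ℝ) (b : ℕ)
    (i : Fin K) : batchPulls N (Fin.snoc (α := fun _ => Fin K × ℝ) h (a, x)) b i =
      batchPulls N h b i + if t / N = b ∧ a = i then 1 else 0 := by
  simp [batchPulls, Fin.sum_univ_castSucc, -Finset.sum_boole]

theorem batchDev_snoc {t : ℕ} (N : ℕ) (P : Fin K → ℝ) (h : Fin t → Fin K × ℝ) (a : Fin K) (x : ℝ)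
    (b : ℕ) (i : Fin K) : batchDev N P (Fin.snoc (α := fun _ => Fin K × ℝ) h (a, x)) b i =
      batchDev N P h b i + if t / N = b ∧ a = i then x - P i else 0 := by
  simp [batchDev, Fin.sum_univ_castSucc]

theorem measurable_batchPulls {t : ℕ} (N b : ℕ) (i : Fin K) :
    Measurable (fun h : Fin t → Fin K × ℝ => batchPulls N h b i) := by
  unfold batchPulls
  refine Finset.measurable_sum _ fun s _ => Measurable.ite ?_ measurable_const measurable_const
  exact (MeasurableSet.const _).inter
    ((measurable_fst.comp (measurable_pi_apply s)) (measurableSet_singleton i))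

theorem measurable_batchDev {t : ℕ} (N : ℕ) (P : Fin K → ℝ) (b : ℕ) (i : Fin K) :
    Measurable (fun h : Fin t → Fin K × ℝ => batchDev N P h b i) := by
  unfold batchDev
  refine Finset.measurable_sum _ fun s _ => Measurable.ite ?_ (by fun_prop) measurable_const
  exact (MeasurableSet.const _).inter
    ((measurable_fst.comp (measurable_pi_apply s)) (measurableSet_singleton i))

/-- The product of the mixtures over the batches and arms. -/
noncomputable def mixtureProd {t : ℕ} (N B : ℕ) (P : Fin K → ℝ) (h : Fin t → Fin K × ℝ) : ENNReal :=
  ∏ c ∈ Finset.range B ×ˢ (Finset.univ : Finset (Fin K)),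
    ENNReal.ofReal (mixture (batchDev N P h c.1 c.2) (batchPulls N h c.1 c.2))

theorem measurable_mixtureProd {t : ℕ} (N B : ℕ) (P : Fin K → ℝ) :
    Measurable (fun h : Fin t → Fin K × ℝ => mixtureProd N B P h) := by
  unfold mixtureProd
  refine Finset.measurable_prod _ fun c _ => ENNReal.measurable_ofReal.comp ?_
  have h1 := measurable_batchDev (t := t) N P c.1 c.2
  have h2 : Measurable (fun h : Fin t → Fin K × ℝ => (batchPulls N h c.1 c.2 : ℝ)) :=
    measurable_from_top.comp (measurable_batchPulls N c.1 c.2)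
  unfold mixture
  fun_prop

/-- One round changes at most one factor, that of the current batch and the sampled arm. That factor
does not increase in conditional mean, however the arm was chosen from the past. -/
theorem lintegral_mixtureProd_le {T : ℕ} (A : Algorithm K T) (ν : Fin K → Measure ℝ)
    (hν : ∀ i, ν i ∈ subGaussianLaws) (N B t : ℕ) :
    ∫⁻ p, mixtureProd N B (means ν) p.2 ∂historyLaw A ν t ≤ 1 := by
  have : ∀ i, IsProbabilityMeasure (ν i) := fun i => (hν i).1
  induction t with
  | zero =>
    have := isProbabilityMeasure_historyLaw A ν 0
    simp [mixtureProd, batchDev, batchPulls, mixture]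
  | succ t ih =>
    rw [lintegral_historyLaw_succ A ν t (f := fun p => mixtureProd N B (means ν) p.2)
      ((measurable_mixtureProd N B _).comp measurable_snd)]
    refine (lintegral_mono fun p => ?_).trans ih
    set a := A.sample t p with ha
    by_cases hb : t / N ∈ Finset.range B
    · have hmem : (t / N, a) ∈ Finset.range B ×ˢ (Finset.univ : Finset (Fin K)) := by
        simpa using hb
      have hother : ∀ x, ∀ c ∈ (Finset.range B ×ˢ (Finset.univ : Finset (Fin K))).erase (t / N, a),
          ENNReal.ofReal (mixture (batchDev N (means ν) (extend A t p x).2 c.1 c.2)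
            (batchPulls N (extend A t p x).2 c.1 c.2)) =
          ENNReal.ofReal (mixture (batchDev N (means ν) p.2 c.1 c.2)
            (batchPulls N p.2 c.1 c.2)) := by
        intro x c hc
        have hne : ¬ (t / N = c.1 ∧ A.sample t p = c.2) := fun h =>
          (Finset.mem_erase.1 hc).1 (Prod.ext h.1.symm h.2.symm)
        simp only [extend, batchDev_snoc, batchPulls_snoc, hne, if_false, add_zero]
      have hsplit : ∀ x, mixtureProd N B (means ν) (extend A t p x).2 =
          ENNReal.ofReal (mixture (batchDev N (means ν) p.2 (t / N) a + (x - means ν a))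
            (batchPulls N p.2 (t / N) a + 1)) *
          ∏ c ∈ (Finset.range B ×ˢ (Finset.univ : Finset (Fin K))).erase (t / N, a),
            ENNReal.ofReal (mixture (batchDev N (means ν) p.2 c.1 c.2)
              (batchPulls N p.2 c.1 c.2)) := by
        intro x
        unfold mixtureProd
        rw [← Finset.mul_prod_erase _ _ hmem, Finset.prod_congr rfl (hother x)]
        simp only [extend, batchDev_snoc, batchPulls_snoc, ← ha, and_self, if_true]
      have hm : Measurable fun x => ENNReal.ofReal (mixture (batchDev N (means ν) p.2 (t / N) a
          + (x - means ν a)) (batchPulls N p.2 (t / N) a + 1)) := by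
        unfold mixture; fun_prop
      simp_rw [hsplit]
      rw [lintegral_mul_const _ hm]
      unfold mixtureProd
      rw [← Finset.mul_prod_erase _ _ hmem]
      gcongr
      exact lintegral_mixture_le (hν a) _ _
    · have hsame : ∀ x, mixtureProd N B (means ν) (extend A t p x).2
          = mixtureProd N B (means ν) p.2 := by
        intro x
        refine Finset.prod_congr rfl fun c hc => ?_
        have hne : ¬ (t / N = c.1 ∧ A.sample t p = c.2) := fun h =>
          hb (h.1 ▸ (Finset.mem_product.1 hc).1)
        simp only [extend, batchDev_snoc, batchPulls_snoc, hne, if_false, add_zero]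
      simp [hsame]

theorem batchPulls_le {t : ℕ} {N : ℕ} (hN : 0 < N) (h : Fin t → Fin K × ℝ) (b : ℕ) (i : Fin K) :
    batchPulls N h b i ≤ N := by
  unfold batchPulls
  rw [Finset.sum_boole, Nat.cast_id]
  refine (Finset.card_le_card_of_injOn (t := Finset.Ico (b * N) ((b + 1) * N)) (fun s : Fin t => (s : ℕ))
    ?_ ?_).trans ?_
  · intro s hs
    have hs := (Finset.mem_filter.1 hs).2.1
    have := (Nat.div_eq_iff hN).1 hs
    simp only [Finset.coe_Ico, Set.mem_Ico]
    constructor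
    · omega
    · rw [add_mul]; omega
  · exact fun s _ s' _ h => Fin.ext h
  · simp [add_mul]

/-- The total normalized squared deviation over the batches and arms. -/
noncomputable def deviation {t : ℕ} (N B : ℕ) (P : Fin K → ℝ) (h : Fin t → Fin K × ℝ) : ℝ :=
  ∑ c ∈ Finset.range B ×ˢ (Finset.univ : Finset (Fin K)),
    batchDev N P h c.1 c.2 ^ 2 / (2 * (batchPulls N h c.1 c.2 + 1))

theorem measurable_deviation {t : ℕ} (N B : ℕ) (P : Fin K → ℝ) :
    Measurable (fun h : Fin t → Fin K × ℝ => deviation N B P h) := by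
  unfold deviation
  refine Finset.measurable_sum _ fun c _ => ?_
  have h1 := measurable_batchDev (t := t) N P c.1 c.2
  have h2 : Measurable (fun h : Fin t → Fin K × ℝ => (batchPulls N h c.1 c.2 : ℝ)) :=
    measurable_from_top.comp (measurable_batchPulls N c.1 c.2)
  fun_prop

theorem exp_deviation_le {t : ℕ} {N : ℕ} (hN : 0 < N) (B : ℕ) (P : Fin K → ℝ)
    (h : Fin t → Fin K × ℝ) :
    ENNReal.ofReal (Real.exp (deviation N B P h)) ≤
      ENNReal.ofReal ((N + 1) ^ (B * K)) * mixtureProd N B P h := by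
  unfold mixtureProd deviation
  rw [← ENNReal.ofReal_prod_of_nonneg fun c _ => (mixture_pos _ _).le,
    ← ENNReal.ofReal_mul (by positivity), Real.exp_sum]
  have hc : (Finset.range B ×ˢ (Finset.univ : Finset (Fin K))).card = B * K := by simp
  rw [← hc, ← Finset.prod_const, ← Finset.prod_mul_distrib]
  refine ENNReal.ofReal_le_ofReal (Finset.prod_le_prod (fun _ _ => (Real.exp_pos _).le)
    fun c _ => ?_)
  unfold mixture
  have h1 : (batchPulls N h c.1 c.2 : ℝ) ≤ N := by exact_mod_cast batchPulls_le hN h c.1 c.2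
  have h2 : √((batchPulls N h c.1 c.2 : ℝ) + 1) ≤ N + 1 := by
    rw [Real.sqrt_le_left (by positivity)]
    nlinarith
  rw [mul_div_assoc', le_div_iff₀ (by positivity), mul_comm]
  gcongr

/-- Markov's inequality for the product of mixtures. Each of the `B * K` normalizations `√(n+1)` is
bounded crudely by `N + 1`, since a batch holds at most `N` pulls. -/
theorem measure_deviation_ge_le {T : ℕ} (A : Algorithm K T) (ν : Fin K → Measure ℝ)
    (hν : ∀ i, ν i ∈ subGaussianLaws) {N : ℕ} (hN : 0 < N) (B t : ℕ) (x : ℝ) :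
    historyLaw A ν t {p | x ≤ deviation N B (means ν) p.2} ≤
      ENNReal.ofReal ((N + 1) ^ (B * K) * Real.exp (-x)) := by
  have hm : Measurable (fun p : A.Seed × (Fin t → Fin K × ℝ) => deviation N B (means ν) p.2) :=
    (measurable_deviation N B _).comp measurable_snd
  have hm' : Measurable (fun p : A.Seed × (Fin t → Fin K × ℝ) =>
    mixtureProd N B (means ν) p.2) := (measurable_mixtureProd N B _).comp measurable_snd
  rw [← lintegral_indicator_one (measurableSet_le measurable_const hm)]
  calc _ ≤ ∫⁻ p, ENNReal.ofReal ((N + 1) ^ (B * K) * Real.exp (-x)) *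
          mixtureProd N B (means ν) p.2 ∂historyLaw A ν t := by
        refine lintegral_mono fun p => ?_
        by_cases hp : x ≤ deviation N B (means ν) p.2
        · rw [Set.indicator_of_mem (by exact hp), Pi.one_apply, mul_comm ((_ : ℝ) ^ _),
            ENNReal.ofReal_mul (Real.exp_pos _).le, mul_assoc]
          refine le_trans ?_ (mul_le_mul_right (exp_deviation_le hN B (means ν) p.2) _)
          rw [← ENNReal.ofReal_mul (Real.exp_pos _).le, ← Real.exp_add, ← ENNReal.ofReal_one]
          exact ENNReal.ofReal_le_ofReal (Real.one_le_exp (by linarith))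
        · rw [Set.indicator_of_notMem (by exact hp)]
          exact zero_le
    _ ≤ _ := by
        rw [lintegral_const_mul _ hm']
        exact mul_le_of_le_one_right zero_le (lintegral_mixtureProd_le A ν hν N B t)

end Concentration

/-! ### The allocation function -/

section Allocation

variable {K : ℕ} {P Q : Fin K → ℝ} {a m : Fin K}

theorem gap_eq_of_mem (h : m ∈ bestArms Q) (j : Fin K) : gap Q j = Q m - Q j := by
  have hm : ∀ j, Q j ≤ Q m := (Finset.mem_filter.1 h).2
  have : Nonempty (Fin K) := ⟨m⟩
  have : (⨆ j, Q j) = Q m :=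
    le_antisymm (ciSup_le hm) (le_ciSup (Set.finite_range Q).bddAbove m)
  rw [gap, this]

theorem gap_eq (h : bestArms Q = {m}) (j : Fin K) : gap Q j = Q m - Q j :=
  gap_eq_of_mem (by simp [h]) j

theorem gap_best (h : bestArms Q = {m}) : gap Q m = 0 := by simp [gap_eq h]

theorem gap_nonneg (h : bestArms Q = {m}) (j : Fin K) : 0 ≤ gap Q j := by
  have : m ∈ bestArms Q := by simp [h]
  have hm : ∀ j, Q j ≤ Q m := (Finset.mem_filter.1 this).2
  rw [gap_eq h]
  linarith [hm j]

theorem gap_pos (h : bestArms Q = {m}) {j : Fin K} (hj : j ≠ m) : 0 < gap Q j := by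
  refine lt_of_le_of_ne (gap_nonneg h j) fun h0 => hj ?_
  rw [gap_eq h] at h0
  have hm : m ∈ bestArms Q := by simp [h]
  have hm : ∀ j, Q j ≤ Q m := (Finset.mem_filter.1 hm).2
  have : j ∈ bestArms Q := Finset.mem_filter.2 ⟨Finset.mem_univ _, fun i => by linarith [hm i]⟩
  simpa [h] using this

theorem riskH1_eq (h : bestArms Q = {m}) :
    riskH1 Q = ∑ i ∈ Finset.univ.erase m, 1 / gap Q i ^ 2 := by
  classical
  rw [riskH1, h, ← Finset.sdiff_singleton_eq_erase]

theorem exists_ne_of_two_le (hK : 2 ≤ K) (m : Fin K) : ∃ j : Fin K, j ≠ m := by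
  have : Nontrivial (Fin K) := Fin.nontrivial_iff_two_le.2 hK
  exact exists_ne m

theorem riskH1_pos (hK : 2 ≤ K) (h : bestArms Q = {m}) : 0 < riskH1 Q := by
  obtain ⟨j, hj⟩ := exists_ne_of_two_le hK m
  rw [riskH1_eq h]
  refine Finset.sum_pos (fun i hi => ?_) ⟨j, by simpa using hj⟩
  have := gap_pos h (Finset.ne_of_mem_erase hi)
  positivity

theorem riskH1Alt_eq (Q : Fin K → ℝ) (i : Fin K) :
    riskH1Alt Q i = ∑ j ∈ Finset.univ.erase i, 1 / (gap Q j + gap Q i) ^ 2 := by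
  rw [riskH1Alt]

theorem riskH1Alt_eq_add (Q : Fin K → ℝ) {i k : Fin K} (hik : i ≠ k) :
    riskH1Alt Q i = 1 / (gap Q k + gap Q i) ^ 2 +
      ∑ j ∈ (Finset.univ.erase i).erase k, 1 / (gap Q j + gap Q i) ^ 2 := by
  rw [riskH1Alt_eq, Finset.add_sum_erase _ (fun j => 1 / (gap Q j + gap Q i) ^ 2)
    (show k ∈ Finset.univ.erase i by simpa using hik.symm)]

theorem allocCost_of_ne (h : bestArms Q = {m}) {j : Fin K} (hj : j ≠ m) :
    allocCost Q j = gap Q j ^ 2 * riskH1Alt Q j := by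
  classical
  have hne : (Finset.univ \ bestArms Q).Nonempty := ⟨j, by simp [h, hj]⟩
  have hj' : j ∉ bestArms Q := by simp [h, hj]
  rw [allocCost, dif_pos (by convert hne), if_neg hj']

theorem allocCost_best_le (h : bestArms Q = {m}) {j : Fin K} (hj : j ≠ m) :
    allocCost Q m ≤ allocCost Q j := by
  classical
  have hne : (Finset.univ \ bestArms Q).Nonempty := ⟨j, by simp [h, hj]⟩
  have hm : m ∈ bestArms Q := by simp [h]
  rw [allocCost_of_ne h hj, allocCost, dif_pos (by convert hne), if_pos hm]
  exact Finset.inf'_le (fun j => gap Q j ^ 2 * riskH1Alt Q j) (by simp [h, hj])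

theorem exists_allocCost_best_eq (hK : 2 ≤ K) (h : bestArms Q = {m}) :
    ∃ j, j ≠ m ∧ allocCost Q m = allocCost Q j := by
  classical
  obtain ⟨i, hi⟩ := exists_ne_of_two_le hK m
  have hne : (Finset.univ \ bestArms Q).Nonempty := ⟨i, by simp [h, hi]⟩
  have hm : m ∈ bestArms Q := by simp [h]
  obtain ⟨j, hj, hjeq⟩ := Finset.exists_mem_eq_inf' hne (fun j => gap Q j ^ 2 * riskH1Alt Q j)
  have hj' : j ≠ m := by simpa [h] using hj
  refine ⟨j, hj', ?_⟩
  rw [allocCost_of_ne h hj', ← hjeq, allocCost, dif_pos (by convert hne), if_pos hm]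

theorem allocCost_of_ne_eq_sum (h : bestArms Q = {m}) {j : Fin K} (hj : j ≠ m) :
    allocCost Q j = ∑ i ∈ Finset.univ.erase j, (gap Q j / (gap Q i + gap Q j)) ^ 2 := by
  rw [allocCost_of_ne h hj, riskH1Alt_eq, Finset.mul_sum]
  refine Finset.sum_congr rfl fun i _ => ?_
  rw [div_pow, mul_one_div]

theorem one_le_allocCost (hK : 2 ≤ K) (h : bestArms Q = {m}) (j : Fin K) : 1 ≤ allocCost Q j := by
  have hne : ∀ j, j ≠ m → 1 ≤ allocCost Q j := by
    intro j hj
    have hg := gap_pos h hj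
    rw [allocCost_of_ne_eq_sum h hj]
    have hmem : m ∈ Finset.univ.erase j := by simpa using hj.symm
    refine le_trans ?_ (Finset.single_le_sum (fun i _ => sq_nonneg _) hmem)
    rw [gap_best h, zero_add, div_self hg.ne', one_pow]
  by_cases hj : j = m
  · obtain ⟨i, hi, heq⟩ := exists_allocCost_best_eq hK h
    rw [hj, heq]
    exact hne i hi
  · exact hne j hj

theorem allocCost_le (hK : 2 ≤ K) (h : bestArms Q = {m}) (j : Fin K) : allocCost Q j ≤ K := by
  have hne : ∀ j, j ≠ m → allocCost Q j ≤ K := by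
    intro j hj
    have hg := gap_pos h hj
    rw [allocCost_of_ne_eq_sum h hj]
    refine (Finset.sum_le_card_nsmul _ _ 1 fun i _ => ?_).trans ?_
    · have := gap_nonneg h i
      refine pow_le_one₀ (by positivity) ?_
      rw [div_le_one (by positivity)]
      linarith
    · simp
  by_cases hj : j = m
  · obtain ⟨i, hi, heq⟩ := exists_allocCost_best_eq hK h
    rw [hj, heq]
    exact hne i hi
  · exact hne j hj

/-- Without ties the ranks are `1, …, |s|` and the sum is exactly harmonic; ties only raise ranks.
The induction inserts a maximal element, whose rank is the full cardinality, while the other ranks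
do not drop. -/
theorem sum_inv_rank_le {ι : Type*} [DecidableEq ι] (f : ι → ℝ) (s : Finset ι) :
    ∑ k ∈ s, 1 / ((s.filter (fun j => f j ≤ f k)).card : ℝ) ≤ harmonic s.card := by
  induction s using Finset.induction_on_max_value f with
  | empty => simp
  | insert a s ha hmax ih =>
    rw [Finset.sum_insert ha, Finset.card_insert_of_notMem ha, harmonic_succ, add_comm]
    push_cast
    refine add_le_add (le_trans (Finset.sum_le_sum fun k hk => ?_) ih) ?_
    · have hpos : 0 < (s.filter (fun j => f j ≤ f k)).card :=
        Finset.card_pos.2 ⟨k, by simp [hk]⟩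
      refine one_div_le_one_div_of_le (by exact_mod_cast hpos) ?_
      exact_mod_cast Finset.card_le_card
        (Finset.filter_subset_filter _ (Finset.subset_insert a s))
    · have : (insert a s).filter (fun j => f j ≤ f a) = insert a s := by
        refine Finset.filter_true_of_mem fun j hj => ?_
        rcases Finset.mem_insert.1 hj with rfl | hj
        · exact le_rfl
        · exact hmax j hj
      rw [this, Finset.card_insert_of_notMem ha]
      push_cast
      rw [one_div]

/-- Every arm with gap at most `Δ_k` contributes at least `(1/2)²` to the cost of `k`. The sum omits
`k` itself, but `m` replaces it, so the count is unchanged. -/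
theorem rank_le_allocCost (h : bestArms Q = {m}) {k : Fin K} (hk : k ≠ m) :
    (((Finset.univ.erase m).filter (fun j => gap Q j ≤ gap Q k)).card : ℝ) / 4 ≤ allocCost Q k := by
  classical
  have hg := gap_pos h hk
  rw [allocCost_of_ne_eq_sum h hk]
  set s := (Finset.univ.erase m).filter (fun j => gap Q j ≤ gap Q k)
  have hks : k ∈ s := by simp [s, hk]
  have hms : m ∉ s.erase k := by simp [s]
  have hsub : insert m (s.erase k) ⊆ Finset.univ.erase k := by
    intro j hj
    rcases Finset.mem_insert.1 hj with rfl | hj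
    · simpa using hk.symm
    · simpa using Finset.ne_of_mem_erase hj
  have hcard : (insert m (s.erase k)).card = s.card := by
    rw [Finset.card_insert_of_notMem hms, Finset.card_erase_of_mem hks]
    have := Finset.card_pos.2 ⟨k, hks⟩
    omega
  refine le_trans ?_ (Finset.sum_le_sum_of_subset_of_nonneg hsub fun i _ _ => sq_nonneg _)
  rw [← hcard, div_eq_mul_one_div, ← nsmul_eq_mul]
  refine Finset.card_nsmul_le_sum _ _ _ fun i hi => ?_
  have hi' : gap Q i ≤ gap Q k := by
    rcases Finset.mem_insert.1 hi with rfl | hi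
    · rw [gap_best h]; exact hg.le
    · exact (Finset.mem_filter.1 (Finset.mem_of_mem_erase hi)).2
  have h0 := gap_nonneg h i
  have : 1 / 2 ≤ gap Q k / (gap Q i + gap Q k) := by
    rw [div_le_div_iff₀ (by norm_num) (by positivity)]
    linarith
  nlinarith

/-- The source of `log K`: costs grow at least linearly in the rank, so the inverses sum like a
harmonic series. This gives `1 + 4 (1 + log K)`, and `log K ≥ log 2` absorbs the constant 5 into `12
log K`. -/
theorem sum_inv_allocCost_le (hK : 2 ≤ K) (h : bestArms Q = {m}) :
    ∑ j, 1 / allocCost Q j ≤ 12 * Real.log K := by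
  classical
  rw [← Finset.add_sum_erase _ _ (Finset.mem_univ m)]
  have h1 : 1 / allocCost Q m ≤ 1 := by
    rw [div_le_one (by linarith [one_le_allocCost hK h m])]
    exact one_le_allocCost hK h m
  have h2 : ∑ j ∈ Finset.univ.erase m, 1 / allocCost Q j ≤
      4 * ∑ k ∈ Finset.univ.erase m,
        1 / (((Finset.univ.erase m).filter (fun j => gap Q j ≤ gap Q k)).card : ℝ) := by
    rw [Finset.mul_sum]
    refine Finset.sum_le_sum fun k hk => ?_
    have hpos : 0 < ((Finset.univ.erase m).filter (fun j => gap Q j ≤ gap Q k)).card :=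
      Finset.card_pos.2 ⟨k, by simpa using hk⟩
    have hpos' : (0 : ℝ) < ((Finset.univ.erase m).filter (fun j => gap Q j ≤ gap Q k)).card := by
      exact_mod_cast hpos
    have := rank_le_allocCost h (Finset.ne_of_mem_erase hk)
    rw [mul_one_div, div_le_div_iff₀ (by linarith [one_le_allocCost hK h k]) hpos']
    linarith
  have h3 := sum_inv_rank_le (fun j => gap Q j) (Finset.univ.erase m)
  have hcard : (Finset.univ.erase m).card = K - 1 := by simp
  rw [hcard] at h3
  have h4 := harmonic_le_one_add_log (K - 1)
  have h5 : Real.log ((K - 1 : ℕ) : ℝ) ≤ Real.log K :=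
    Real.log_le_log (by exact_mod_cast (by omega : 0 < K - 1)) (by exact_mod_cast Nat.sub_le K 1)
  have h6 : Real.log 2 ≤ Real.log K := Real.log_le_log (by norm_num) (by exact_mod_cast hK)
  have := Real.log_two_gt_d9
  linarith

theorem sum_inv_allocCost_pos (hK : 2 ≤ K) (h : bestArms Q = {m}) :
    0 < ∑ j, 1 / allocCost Q j :=
  Finset.sum_pos (fun j _ => one_div_pos.2 (by linarith [one_le_allocCost hK h j])) ⟨m, by simp⟩

theorem allocation_pos (hK : 2 ≤ K) (h : bestArms Q = {m}) (k : Fin K) : 0 < allocation Q k := by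
  have := one_le_allocCost hK h k
  have := sum_inv_allocCost_pos hK h
  unfold allocation
  positivity

theorem sum_allocation (hK : 2 ≤ K) (h : bestArms Q = {m}) : ∑ k, allocation Q k = 1 := by
  have := sum_inv_allocCost_pos hK h
  unfold allocation
  simp_rw [← one_div_mul_one_div]
  rw [← Finset.sum_mul, mul_one_div_cancel this.ne']

theorem le_allocation (hK : 2 ≤ K) (h : bestArms Q = {m}) (k : Fin K) :
    1 / (K : ℝ) ^ 2 ≤ allocation Q k := by
  have h1 := one_le_allocCost hK h k
  have h2 := sum_inv_allocCost_pos hK h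
  have h3 : ∑ j, 1 / allocCost Q j ≤ K := by
    refine (Finset.sum_le_card_nsmul _ _ 1 fun i _ => ?_).trans (by simp)
    rw [div_le_one (by linarith [one_le_allocCost hK h i])]
    exact one_le_allocCost hK h i
  have h4 := allocCost_le hK h k
  refine one_div_le_one_div_of_le (by positivity) ?_
  rw [sq]
  gcongr

theorem one_div_le_allocation (hK : 2 ≤ K) (h : bestArms Q = {m}) (k : Fin K) :
    1 / (12 * Real.log K * allocCost Q k) ≤ allocation Q k := by
  have h1 := one_le_allocCost hK h k
  have h2 := sum_inv_allocCost_pos hK h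
  have h3 := sum_inv_allocCost_le hK h
  refine one_div_le_one_div_of_le (by positivity) ?_
  rw [mul_comm]
  gcongr

/-- The term coupling `k` and `a` is symmetric and occurs in both sums; every other term decreases
when the reference gap grows. -/
theorem riskH1Alt_anti (h : bestArms Q = {m}) {k : Fin K} (ha : a ≠ m)
    (hk : gap Q a ≤ gap Q k) : riskH1Alt Q k ≤ riskH1Alt Q a := by
  by_cases hka : k = a
  · rw [hka]
  have hg := gap_pos h ha
  rw [riskH1Alt_eq_add Q hka, riskH1Alt_eq_add Q (Ne.symm hka), add_comm (gap Q k),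
    Finset.erase_right_comm]
  refine add_le_add le_rfl (Finset.sum_le_sum fun j _ => ?_)
  have := gap_nonneg h j
  gcongr

/-- The map `x ↦ x / (Δ_j + x)` is increasing. The terms in which `k` and `a` meet each other share
a denominator and are compared separately. -/
theorem allocCost_mono (h : bestArms Q = {m}) {k : Fin K} (hkm : k ≠ m) (ha : a ≠ m)
    (hk : gap Q k ≤ gap Q a) : allocCost Q k ≤ allocCost Q a := by
  by_cases hka : k = a
  · rw [hka]
  have hg := gap_pos h ha
  have hg' := gap_pos h hkm
  rw [allocCost_of_ne_eq_sum h hkm, allocCost_of_ne_eq_sum h ha,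
    ← Finset.add_sum_erase _ _ (show a ∈ Finset.univ.erase k by simpa using Ne.symm hka),
    ← Finset.add_sum_erase _ _ (show k ∈ Finset.univ.erase a by simpa using hka),
    Finset.erase_right_comm]
  refine add_le_add ?_ (Finset.sum_le_sum fun j _ => ?_)
  · rw [add_comm (gap Q a)]
    gcongr
  · have := gap_nonneg h j
    have : gap Q k / (gap Q j + gap Q k) ≤ gap Q a / (gap Q j + gap Q a) := by
      rw [div_le_div_iff₀ (by positivity) (by positivity)]
      nlinarith
    gcongr

/-- The term of `m` equals `1 / Δ_k²` and takes the place of the missing term of `k`; the other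
denominators only grow. -/
theorem riskH1Alt_le_riskH1 (h : bestArms Q = {m}) {k : Fin K} (hk : k ≠ m) :
    riskH1Alt Q k ≤ riskH1 Q := by
  have hg := gap_pos h hk
  rw [riskH1Alt_eq_add Q hk, riskH1_eq h,
    ← Finset.add_sum_erase _ _ (show k ∈ Finset.univ.erase m by simpa using hk), gap_best h,
    zero_add, Finset.erase_right_comm]
  refine add_le_add le_rfl (Finset.sum_le_sum fun j hj => ?_)
  have hgj := gap_pos h (Finset.ne_of_mem_erase (Finset.mem_of_mem_erase hj))
  gcongr
  linarith

/-- If the best arm of `P` does not look best in `Q`, then some arm has a large deviation relative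
to its allocation cost. -/
theorem best_eq_of_deviation_le (hK : 2 ≤ K) (hP : bestArms P = {a}) (hQ : bestArms Q = {m})
    (hdev : ∀ k, (Q k - P k) ^ 2 ≤ allocCost Q k / (64 * riskH1 P)) : m = a := by
  by_contra hne
  have ham : a ≠ m := Ne.symm hne
  have hH := riskH1_pos hK hP
  have hga := gap_pos hQ ham
  have hG : 0 < riskH1Alt Q a := by
    rw [riskH1Alt_eq_add Q ham]
    have : 0 ≤ ∑ j ∈ (Finset.univ.erase a).erase m, 1 / (gap Q j + gap Q a) ^ 2 :=
      Finset.sum_nonneg fun j _ => by positivity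
    have := gap_nonneg hQ m
    positivity
  -- `s` is the relative size of the allowed deviations: the bound for arm `a` is exactly `s * gap Q
  -- a`. The aim is a self-consistent inequality that forces `s` to be small.
  obtain ⟨s, hs0, hs⟩ : ∃ s : ℝ, 0 ≤ s ∧ s ^ 2 = riskH1Alt Q a / (64 * riskH1 P) :=
    ⟨√(riskH1Alt Q a / (64 * riskH1 P)), Real.sqrt_nonneg _, Real.sq_sqrt (by positivity)⟩
  have hDa : allocCost Q a / (64 * riskH1 P) = (s * gap Q a) ^ 2 := by
    rw [mul_pow, hs, allocCost_of_ne hQ ham]; ring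
  have hnear : ∀ k, allocCost Q k ≤ allocCost Q a → |Q k - P k| ≤ s * gap Q a := by
    intro k hk
    refine abs_le_of_sq_le_sq ?_ (by positivity)
    refine (hdev k).trans ?_
    rw [← hDa]
    gcongr
  -- Arms with smaller gap than `a` cost no more than `a`. For arms with larger gap, the factor
  -- `riskH1Alt` is at most that of `a`, so their deviation scales with their own gap.
  have hall : ∀ k, |Q k - P k| ≤ s * (gap Q k + gap Q a) := by
    intro k
    have hgk := gap_nonneg hQ k
    by_cases hkm : k = m
    · have := hnear k (by rw [hkm]; exact allocCost_best_le hQ ham)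
      nlinarith
    rcases le_total (gap Q k) (gap Q a) with hle | hle
    · have := hnear k (allocCost_mono hQ hkm ham hle)
      nlinarith
    · have : |Q k - P k| ≤ s * gap Q k := by
        refine abs_le_of_sq_le_sq ?_ (by positivity)
        refine (hdev k).trans ?_
        rw [mul_pow, hs, allocCost_of_ne hQ hkm, div_mul_eq_mul_div, mul_comm (riskH1Alt Q a)]
        have := riskH1Alt_anti hQ ham hle
        gcongr
      nlinarith
  have hya := abs_le.1 (hnear a le_rfl)
  have hgapP : ∀ k, gap P k ≤ (1 + 2 * s) * (gap Q k + gap Q a) := by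
    intro k
    have hgk := gap_nonneg hQ k
    have hk := abs_le.1 (hall k)
    have e1 := gap_eq hP k
    have e2 := gap_eq hQ k
    have e3 := gap_eq hQ a
    nlinarith
  have hrisk : riskH1Alt Q a ≤ (1 + 2 * s) ^ 2 * riskH1 P := by
    rw [riskH1Alt_eq, riskH1_eq hP, Finset.mul_sum]
    refine Finset.sum_le_sum fun k hk => ?_
    have hgk := gap_pos hP (Finset.ne_of_mem_erase hk)
    have hqk := gap_nonneg hQ k
    rw [mul_one_div, div_le_div_iff₀ (by positivity) (by positivity), one_mul, ← mul_pow]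
    exact pow_le_pow_left₀ hgk.le (hgapP k) 2
  -- The bound on `riskH1Alt Q a` reads `64 s² ≤ (1 + 2s)²`, that is `8s ≤ 1 + 2s`. Then `a` and `m`
  -- each move by at most a sixth of their empirical gap and cannot swap order.
  have hs6 : s ≤ 1 / 6 := by
    have : 64 * s ^ 2 ≤ (1 + 2 * s) ^ 2 := by
      rw [hs, mul_div_assoc', mul_div_mul_left _ _ (by norm_num : (64 : ℝ) ≠ 0), div_le_iff₀ hH]
      exact hrisk
    nlinarith
  have hm := abs_le.1 (hnear m (allocCost_best_le hQ ham))
  have e1 := gap_eq hP m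
  have e3 := gap_eq hQ a
  have := gap_pos hP hne
  nlinarith

theorem allocCost_le_of_deviation_le (hK : 2 ≤ K) (hP : bestArms P = {a}) (hQ : bestArms Q = {a})
    (hdev : ∀ k, (Q k - P k) ^ 2 ≤ allocCost Q k / (64 * riskH1 P)) {k : Fin K} (hk : k ≠ a) :
    allocCost Q k ≤ 4 * gap P k ^ 2 * riskH1 P := by
  have hH := riskH1_pos hK hP
  have hHQ := riskH1_pos hK hQ
  obtain ⟨s, hs0, hs⟩ : ∃ s : ℝ, 0 ≤ s ∧ s ^ 2 = riskH1 Q / (64 * riskH1 P) :=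
    ⟨√(riskH1 Q / (64 * riskH1 P)), Real.sqrt_nonneg _, Real.sq_sqrt (by positivity)⟩
  have hD : ∀ k, k ≠ a → allocCost Q k ≤ gap Q k ^ 2 * riskH1 Q := by
    intro k hk
    rw [allocCost_of_ne hQ hk]
    have := riskH1Alt_le_riskH1 hQ hk
    gcongr
  have hnear : ∀ k, k ≠ a → ∀ i, allocCost Q i ≤ allocCost Q k → |Q i - P i| ≤ s * gap Q k := by
    intro k hk i hi
    have hgk := gap_pos hQ hk
    refine abs_le_of_sq_le_sq ?_ (by positivity)
    refine (hdev i).trans ?_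
    rw [mul_pow, hs, div_mul_eq_mul_div, mul_comm (riskH1 Q)]
    have := hi.trans (hD k hk)
    gcongr
  have hgapP : ∀ k, k ≠ a → |gap P k - gap Q k| ≤ 2 * s * gap Q k := by
    intro k hk
    have h1 := abs_le.1 (hnear k hk k le_rfl)
    have h2 := abs_le.1 (hnear k hk a (allocCost_best_le hQ hk))
    rw [gap_eq hP k]
    have e2 := gap_eq hQ k
    rw [abs_le]
    constructor <;> linarith
  have hrisk : riskH1 Q ≤ (1 + 2 * s) ^ 2 * riskH1 P := by
    rw [riskH1_eq hQ, riskH1_eq hP, Finset.mul_sum]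
    refine Finset.sum_le_sum fun k hk => ?_
    have hk := Finset.ne_of_mem_erase hk
    have hgk := gap_pos hP hk
    have hqk := gap_pos hQ hk
    rw [mul_one_div, div_le_div_iff₀ (by positivity) (by positivity), one_mul, ← mul_pow]
    refine pow_le_pow_left₀ hgk.le ?_ 2
    have := (abs_le.1 (hgapP k hk)).2
    linarith
  -- The same self-consistency, now with `H₁(Q)` in the role of `riskH1Alt Q a`. It yields `Δ_k(Q) ≤
  -- (3/2) Δ_k(P)` and `H₁(Q) ≤ (16/9) H₁(P)`, whence the factor 4.
  have hs6 : s ≤ 1 / 6 := by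
    have : 64 * s ^ 2 ≤ (1 + 2 * s) ^ 2 := by
      rw [hs, mul_div_assoc', mul_div_mul_left _ _ (by norm_num : (64 : ℝ) ≠ 0), div_le_iff₀ hH]
      exact hrisk
    nlinarith
  have hqk := gap_pos hQ hk
  have h1 : 2 / 3 * gap Q k ≤ gap P k := by
    have := (abs_le.1 (hgapP k hk)).1
    nlinarith
  have h2 : riskH1 Q ≤ 16 / 9 * riskH1 P := by
    have e : riskH1 Q = 64 * s ^ 2 * riskH1 P := by rw [hs]; field_simp
    have : s ^ 2 ≤ 1 / 36 := by nlinarith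
    rw [e]
    nlinarith
  calc allocCost Q k ≤ gap Q k ^ 2 * riskH1 Q := hD k hk
    _ ≤ (3 / 2 * gap P k) ^ 2 * (16 / 9 * riskH1 P) := by
        gcongr
        linarith
    _ = _ := by ring

/-- Either some arm deviates a lot relative to its allocation, or the allocation at `Q` is, up to a
constant factor, as good as the one at `P`. -/
theorem deviation_or_allocation (hK : 2 ≤ K) (hP : bestArms P = {a}) (hQ : bestArms Q = {m}) :
    (∃ k, 1 / (768 * riskH1 P * Real.log K) ≤ allocation Q k * (Q k - P k) ^ 2) ∨
    ∀ k j, (k = j ∨ k = a) → j ≠ a →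
      1 / (48 * riskH1 P * Real.log K) ≤ allocation Q k * gap P j ^ 2 := by
  have hH := riskH1_pos hK hP
  have hlog : 0 < Real.log K := Real.log_pos (by exact_mod_cast hK)
  by_cases hdev : ∀ k, (Q k - P k) ^ 2 ≤ allocCost Q k / (64 * riskH1 P)
  · right
    intro k j hkj hj
    have hma := best_eq_of_deviation_le hK hP hQ hdev
    rw [hma] at hQ
    have hkle : allocCost Q k ≤ allocCost Q j := by
      rcases hkj with rfl | rfl
      · exact le_rfl
      · exact allocCost_best_le hQ hj
    have hD := hkle.trans (allocCost_le_of_deviation_le hK hP hQ hdev hj)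
    have hD1 := one_le_allocCost hK hQ k
    have hg := gap_pos hP hj
    refine le_trans ?_ (mul_le_mul_of_nonneg_right (one_div_le_allocation hK hQ k) (sq_nonneg _))
    rw [one_div_mul_eq_div, div_le_div_iff₀ (by positivity) (by positivity)]
    nlinarith
  · left
    push Not at hdev
    obtain ⟨k, hk⟩ := hdev
    refine ⟨k, ?_⟩
    have hD1 := one_le_allocCost hK hQ k
    refine le_trans ?_ (mul_le_mul (one_div_le_allocation hK hQ k) hk.le (by positivity)
      (allocation_pos hK hQ k).le)
    refine le_of_eq ?_
    field_simp
    norm_num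

/-- If the best arm of `P` is not strictly best in `Q`, then some arm deviates by half a gap. -/
theorem exists_half_gap_le (hP : bestArms P = {a}) {j : Fin K} (h : Q a ≤ Q j) :
    ∃ k, (k = j ∨ k = a) ∧ gap P j ^ 2 / 4 ≤ (Q k - P k) ^ 2 := by
  have e := gap_eq hP j
  have h0 := gap_nonneg hP j
  by_contra! hcon
  have h1 := hcon j (Or.inl rfl)
  have h2 := hcon a (Or.inr rfl)
  have h1' := abs_lt.1 (abs_lt_of_sq_lt_sq (a := Q j - P j) (b := gap P j / 2)
    (by rw [div_pow]; linarith) (by linarith))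
  have h2' := abs_lt.1 (abs_lt_of_sq_lt_sq (a := Q a - P a) (b := gap P j / 2)
    (by rw [div_pow]; linarith) (by linarith))
  linarith [h1'.1, h1'.2, h2'.1, h2'.2]

end Allocation

/-! ### Deviations along a tracking sequence -/

section Tracking

/-- One step for the potential `A² / C`: spending `n` pulls while the running average `y = A / C` is
off lowers the potential by a multiple of `n y²`, unless the new noise `e` pays for it. The cross
term is handled by `2yS ≤ n y²/2 + 2e` (AM-GM), and `n ≤ C` controls the term `n² y²`. -/
theorem potential_step {C A n S e : ℝ} (hC : 0 < C) (hn : 0 ≤ n) (hnC : n ≤ C) (he : 0 ≤ e)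
    (hS : S ^ 2 ≤ n * e) :
    n * (A / C) ^ 2 / 4 + (A + S) ^ 2 / (C + n) ≤ A ^ 2 / C + 2 * e := by
  obtain ⟨y, rfl⟩ : ∃ y, A = C * y := ⟨A / C, by field_simp⟩
  have e1 : C * y / C = y := by field_simp
  have e2 : (C * y) ^ 2 / C = C * y ^ 2 := by field_simp
  rw [e1, e2]
  have h1 : (C * y + S) ^ 2 / (C + n) ≤ C * y ^ 2 + 2 * e - n * y ^ 2 / 4 := by
    rw [div_le_iff₀ (by linarith)]
    have hyS : 2 * y * S ≤ n * y ^ 2 / 2 + 2 * e := by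
      have hle : (2 * y * S) ^ 2 ≤ (n * y ^ 2 / 2 + 2 * e) ^ 2 := by
        have : (2 * y * S) ^ 2 ≤ 4 * y ^ 2 * (n * e) := by nlinarith [sq_nonneg y]
        nlinarith [sq_nonneg (n * y ^ 2 / 2 - 2 * e)]
      exact le_of_sq_le_sq hle (by positivity)
    have h2 := mul_le_mul_of_nonneg_left hyS hC.le
    have h3 : n ^ 2 * y ^ 2 ≤ C * n * y ^ 2 := by
      rw [sq n]; gcongr
    have h4 : 0 ≤ n * e := by positivity
    have h5 : 0 ≤ C * n * y ^ 2 := by positivity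
    nlinarith
  linarith

theorem sq_sum_div_sum_le {n S e : ℕ → ℝ} (hn : ∀ b, 0 ≤ n b) (he : ∀ b, 0 ≤ e b)
    (hS : ∀ b, S b ^ 2 ≤ n b * e b) (B : ℕ) :
    (∑ b ∈ Finset.range B, S b) ^ 2 / (∑ b ∈ Finset.range B, n b) ≤ ∑ b ∈ Finset.range B, e b := by
  refine div_le_of_le_mul₀ (Finset.sum_nonneg fun b _ => hn b) (Finset.sum_nonneg fun b _ => he b) ?_
  rw [mul_comm]
  exact Finset.sum_sq_le_sum_mul_sum_of_sq_le_mul _ (fun b _ => hn b) (fun b _ => he b)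
    (fun b _ => hS b)

/-- A Hardy-type inequality for running weighted averages. -/
theorem sum_mul_sq_average_le {n S e : ℕ → ℝ} (hn : ∀ b, 0 ≤ n b) (he : ∀ b, 0 ≤ e b)
    (hS : ∀ b, S b ^ 2 ≤ n b * e b) {b₀ B : ℕ} (hB : b₀ ≤ B)
    (hC : ∀ b, b₀ ≤ b → b < B →
      0 < ∑ c ∈ Finset.range b, n c ∧ n b ≤ ∑ c ∈ Finset.range b, n c) :
    ∑ b ∈ Finset.Ico b₀ B,
      n b * ((∑ c ∈ Finset.range b, S c) / (∑ c ∈ Finset.range b, n c)) ^ 2 ≤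
      8 * ∑ b ∈ Finset.range B, e b := by
  -- Carrying the potential along makes the sum telescope. At `b₀` the potential is at most the
  -- accumulated noise by Cauchy–Schwarz.
  suffices h : (∑ b ∈ Finset.Ico b₀ B,
      n b * ((∑ c ∈ Finset.range b, S c) / (∑ c ∈ Finset.range b, n c)) ^ 2) / 4 +
      (∑ b ∈ Finset.range B, S b) ^ 2 / (∑ b ∈ Finset.range B, n b) ≤
      2 * ∑ b ∈ Finset.range B, e b by
    have : 0 ≤ (∑ b ∈ Finset.range B, S b) ^ 2 / (∑ b ∈ Finset.range B, n b) :=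
      div_nonneg (sq_nonneg _) (Finset.sum_nonneg fun b _ => hn b)
    linarith
  induction B, hB using Nat.le_induction with
  | base =>
    have h1 := sq_sum_div_sum_le hn he hS b₀
    have h2 : 0 ≤ ∑ b ∈ Finset.range b₀, e b := Finset.sum_nonneg fun b _ => he b
    simp only [Finset.Ico_self, Finset.sum_empty]
    linarith
  | succ B hB ih =>
    have ih := ih fun b h1 h2 => hC b h1 (by omega)
    obtain ⟨h1, h2⟩ := hC B hB (by omega)
    have := potential_step (A := ∑ c ∈ Finset.range B, S c) h1 (hn B) h2 (he B) (hS B)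
    rw [Finset.sum_Ico_succ_top hB, Finset.sum_range_succ, Finset.sum_range_succ,
      Finset.sum_range_succ]
    linarith

variable {K : ℕ} {P : Fin K → ℝ} {a : Fin K}

/-- Lower bound on the total deviation along a sequence of batches that tracks the allocation
of the running averages and ends with a wrong best arm. -/
theorem le_total_deviation (hK : 2 ≤ K) (hP : bestArms P = {a}) {N : ℝ} (hN : 0 ≤ N) {b₀ B : ℕ}
    (hB₁ : B ≤ 4 * b₀) (hB₂ : 2 * b₀ ≤ B) {n S e Q : ℕ → Fin K → ℝ} (hn : ∀ b k, 0 ≤ n b k)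
    (he : ∀ b k, 0 ≤ e b k) (hS : ∀ b k, S b k ^ 2 ≤ n b k * e b k)
    (hQ : ∀ b, b₀ ≤ b → b < B → ∃ m, bestArms (Q b) = {m})
    (hy : ∀ b, b₀ ≤ b → b < B → ∀ k, Q b k - P k =
      (∑ c ∈ Finset.range b, S c k) / (∑ c ∈ Finset.range b, n c k))
    (hC : ∀ b, b₀ ≤ b → b < B → ∀ k,
      0 < ∑ c ∈ Finset.range b, n c k ∧ n b k ≤ ∑ c ∈ Finset.range b, n c k)
    (htrack : ∀ b, b₀ ≤ b → b < B → ∀ k, N / 2 * allocation (Q b) k ≤ n b k ∨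
      N / 2 * b * allocation (Q b) k ≤ ∑ c ∈ Finset.range b, n c k)
    (hfin : ∃ j k, (k = j ∨ k = a) ∧ j ≠ a ∧
      gap P j ^ 2 / 4 ≤
        ((∑ c ∈ Finset.range (B + 1), S c k) / (∑ c ∈ Finset.range (B + 1), n c k)) ^ 2) :
    N * B / (49152 * (riskH1 P * Real.log K)) ≤ ∑ b ∈ Finset.range (B + 1), ∑ k, e b k := by
  classical
  have hH := riskH1_pos hK hP
  have hlog : 0 < Real.log K := Real.log_pos (by exact_mod_cast hK)
  set L := riskH1 P * Real.log K with hLdef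
  have hL : 0 < L := by positivity
  set E := ∑ b ∈ Finset.range (B + 1), ∑ k, e b k with hE
  have hdich : ∀ b, b₀ ≤ b → b < B →
      (∃ k, 1 / (768 * L) ≤ allocation (Q b) k * (Q b k - P k) ^ 2) ∨
      ∀ k j, (k = j ∨ k = a) → j ≠ a → 1 / (48 * L) ≤ allocation (Q b) k * gap P j ^ 2 := by
    intro b h1 h2
    obtain ⟨m, hm⟩ := hQ b h1 h2
    have := deviation_or_allocation hK hP hm
    rwa [mul_assoc, mul_assoc] at this
  have hEk : ∀ k b, b ≤ B + 1 → ∑ c ∈ Finset.range b, e c k ≤ E := by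
    intro k b hb
    refine (Finset.sum_le_sum_of_subset_of_nonneg (Finset.range_mono hb)
      fun c _ _ => he c k).trans ?_
    exact Finset.sum_le_sum fun c _ => Finset.single_le_sum (f := fun k => e c k)
      (fun k _ => he c k) (Finset.mem_univ k)
  have hCy : ∀ k b, b ≤ B + 1 → (∑ c ∈ Finset.range b, n c k) *
      ((∑ c ∈ Finset.range b, S c k) / (∑ c ∈ Finset.range b, n c k)) ^ 2 ≤ E := by
    intro k b hb
    refine le_trans ?_ ((sq_sum_div_sum_le (fun b => hn b k) (fun b => he b k)
      (fun b => hS b k) b).trans (hEk k b hb))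
    rcases eq_or_ne (∑ c ∈ Finset.range b, n c k) 0 with h0 | h0
    · rw [h0]; simp
    · refine le_of_eq ?_
      field_simp
  have hB4 : (B : ℝ) / 4 ≤ b₀ := by
    have : (B : ℝ) ≤ 4 * b₀ := by exact_mod_cast hB₁
    linarith
  have hb4 : ∀ b : ℕ, b₀ ≤ b → (B : ℝ) / 4 ≤ b := fun b hb =>
    hB4.trans (by exact_mod_cast hb)
  have hgoal : ∀ c : ℝ, c ≤ 49152 → 0 < c → N * B / (c * L) ≤ E → N * B / (49152 * L) ≤ E := by
    intro c hc hc0 h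
    refine le_trans ?_ h
    gcongr
  -- First case: a deviating arm that already has its share of pulls. With `b ≥ B/4`, its
  -- accumulated pulls times its squared deviation are large, and Cauchy–Schwarz bounds this product
  -- by `E`.
  by_cases hsuf : ∃ b, b₀ ≤ b ∧ b < B ∧ ∃ k,
      1 / (768 * L) ≤ allocation (Q b) k * (Q b k - P k) ^ 2 ∧
      N / 2 * b * allocation (Q b) k ≤ ∑ c ∈ Finset.range b, n c k
  · obtain ⟨b, h1, h2, k, hk, hk'⟩ := hsuf
    refine hgoal 6144 (by norm_num) (by norm_num) ?_
    refine le_trans ?_ (hCy k b (by omega))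
    rw [← hy b h1 h2 k]
    calc N * B / (6144 * L) = N / 2 * (B / 4) * (1 / (768 * L)) := by
          field_simp; ring
      _ ≤ N / 2 * b * (allocation (Q b) k * (Q b k - P k) ^ 2) := by
          have := hb4 b h1
          gcongr
      _ = N / 2 * b * allocation (Q b) k * (Q b k - P k) ^ 2 := by ring
      _ ≤ _ := by gcongr
  push Not at hsuf
  set X := (Finset.Ico b₀ B).filter
    (fun b => ∃ k, 1 / (768 * L) ≤ allocation (Q b) k * (Q b k - P k) ^ 2) with hX
  by_cases hcard : B ≤ 4 * X.card
  -- Second case: in at least `B/4` batches a deviating arm is insufficiently drawn, so the batch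
  -- itself spends pulls on it. The Hardy-type bound costs a factor 8, and `49152 = 768 · 2 · 4 ·
  -- 8`.
  · refine hgoal 49152 le_rfl (by norm_num) ?_
    have hX1 : ∀ b ∈ X, N / 2 * (1 / (768 * L)) ≤ ∑ k, n b k *
        ((∑ c ∈ Finset.range b, S c k) / (∑ c ∈ Finset.range b, n c k)) ^ 2 := by
      intro b hb
      obtain ⟨hb, k, hk⟩ := Finset.mem_filter.1 hb
      obtain ⟨h1, h2⟩ := Finset.mem_Ico.1 hb
      have hins := (htrack b h1 h2 k).resolve_right (not_le.2 (hsuf b h1 h2 k hk))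
      refine le_trans ?_ (Finset.single_le_sum (f := fun k => n b k *
        ((∑ c ∈ Finset.range b, S c k) / (∑ c ∈ Finset.range b, n c k)) ^ 2)
        (fun k _ => mul_nonneg (hn b k) (sq_nonneg _)) (Finset.mem_univ k))
      rw [← hy b h1 h2 k]
      calc N / 2 * (1 / (768 * L)) ≤ N / 2 * (allocation (Q b) k * (Q b k - P k) ^ 2) := by gcongr
        _ = N / 2 * allocation (Q b) k * (Q b k - P k) ^ 2 := by ring
        _ ≤ _ := by gcongr
    have h8 : ∑ b ∈ Finset.Ico b₀ B, ∑ k, n b k *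
        ((∑ c ∈ Finset.range b, S c k) / (∑ c ∈ Finset.range b, n c k)) ^ 2 ≤ 8 * E := by
      rw [Finset.sum_comm]
      calc _ ≤ ∑ k, 8 * ∑ b ∈ Finset.range B, e b k :=
            Finset.sum_le_sum fun k _ => sum_mul_sq_average_le (fun b => hn b k)
              (fun b => he b k) (fun b => hS b k) (by omega) (fun b h1 h2 => hC b h1 h2 k)
        _ = 8 * ∑ b ∈ Finset.range B, ∑ k, e b k := by rw [← Finset.mul_sum, Finset.sum_comm]
        _ ≤ 8 * E := by
            refine mul_le_mul_of_nonneg_left ?_ (by norm_num)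
            exact Finset.sum_le_sum_of_subset_of_nonneg (Finset.range_mono (Nat.le_succ B))
              fun b _ _ => Finset.sum_nonneg fun k _ => he b k
    have h9 := (Finset.card_nsmul_le_sum X _ _ hX1).trans
      ((Finset.sum_le_sum_of_subset_of_nonneg (Finset.filter_subset _ _) fun b _ _ =>
        Finset.sum_nonneg fun k _ => mul_nonneg (hn b k) (sq_nonneg _)).trans h8)
    rw [nsmul_eq_mul] at h9
    have h10 : (B : ℝ) / 4 ≤ X.card := by
      have : (B : ℝ) ≤ 4 * X.card := by exact_mod_cast hcard
      linarith
    have h11 : (B : ℝ) / 4 * (N / 2 * (1 / (768 * L))) ≤ 8 * E :=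
      le_trans (by gcongr) h9
    have h12 : N * B / (49152 * L) = (B : ℝ) / 4 * (N / 2 * (1 / (768 * L))) / 8 := by
      field_simp; ring
    rw [h12]
    linarith
  -- Third case: more than `B/4` of the at least `B/2` batches in the window have an allocation good
  -- for `P`. Whether arm `k` was sufficient in one of them or insufficient in all, its final pull
  -- count resolves `gap P j`, so the final half-gap deviation is expensive.
  · obtain ⟨j, k, hkj, hj, hfin⟩ := hfin
    refine hgoal 1536 (by norm_num) (by norm_num) ?_
    refine le_trans ?_ (hCy k (B + 1) le_rfl)
    have hmono : ∀ b, b ≤ B + 1 → ∑ c ∈ Finset.range b, n c k ≤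
        ∑ c ∈ Finset.range (B + 1), n c k := fun b hb =>
      Finset.sum_le_sum_of_subset_of_nonneg (Finset.range_mono hb) fun c _ _ => hn c k
    have hCg : N / 2 * (B / 4) * (1 / (48 * L)) ≤
        (∑ c ∈ Finset.range (B + 1), n c k) * gap P j ^ 2 := by
      set Y := (Finset.Ico b₀ B) \ X with hY
      have hcheap : ∀ b ∈ Y, (b₀ ≤ b ∧ b < B) ∧
          1 / (48 * L) ≤ allocation (Q b) k * gap P j ^ 2 := by
        intro b hb
        obtain ⟨hb, hbX⟩ := Finset.mem_sdiff.1 hb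
        have hb' := Finset.mem_Ico.1 hb
        refine ⟨hb', ?_⟩
        refine (hdich b hb'.1 hb'.2).resolve_left (fun h => hbX ?_) k j hkj hj
        exact Finset.mem_filter.2 ⟨hb, h⟩
      by_cases hsuf' : ∃ b ∈ Y, N / 2 * b * allocation (Q b) k ≤ ∑ c ∈ Finset.range b, n c k
      · obtain ⟨b, hb, hbs⟩ := hsuf'
        obtain ⟨⟨h1, h2⟩, h3⟩ := hcheap b hb
        calc N / 2 * (B / 4) * (1 / (48 * L))
            ≤ N / 2 * b * (allocation (Q b) k * gap P j ^ 2) := by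
              have := hb4 b h1
              gcongr
          _ = N / 2 * b * allocation (Q b) k * gap P j ^ 2 := by ring
          _ ≤ _ := by
              have := hbs.trans (hmono b (by omega))
              gcongr
      · push Not at hsuf'
        have hYX : Y.card + X.card = B - b₀ := by
          rw [hY, Finset.card_sdiff_add_card_eq_card (Finset.filter_subset _ _), Nat.card_Ico]
        have hYcard : (B : ℝ) / 4 ≤ Y.card := by
          have : B ≤ 4 * Y.card := by omega
          have : (B : ℝ) ≤ 4 * Y.card := by exact_mod_cast this
          linarith
        have h1 : ∀ b ∈ Y, N / 2 * (1 / (48 * L)) ≤ n b k * gap P j ^ 2 := by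
          intro b hb
          obtain ⟨⟨h1, h2⟩, h3⟩ := hcheap b hb
          have hins := (htrack b h1 h2 k).resolve_right (not_le.2 (hsuf' b hb))
          calc N / 2 * (1 / (48 * L)) ≤ N / 2 * (allocation (Q b) k * gap P j ^ 2) := by gcongr
            _ = N / 2 * allocation (Q b) k * gap P j ^ 2 := by ring
            _ ≤ _ := by gcongr
        have h2 := Finset.card_nsmul_le_sum Y _ _ h1
        rw [nsmul_eq_mul, ← Finset.sum_mul] at h2
        have hsub : Y ⊆ Finset.range (B + 1) := by
          intro b hb
          have := (hcheap b hb).1.2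
          exact Finset.mem_range.2 (by omega)
        calc N / 2 * (B / 4) * (1 / (48 * L)) = B / 4 * (N / 2 * (1 / (48 * L))) := by ring
          _ ≤ Y.card * (N / 2 * (1 / (48 * L))) := by gcongr
          _ ≤ _ := h2
          _ ≤ _ := by
              have := Finset.sum_le_sum_of_subset_of_nonneg hsub fun b _ _ => hn b k
              gcongr
    have hn0 : 0 ≤ ∑ c ∈ Finset.range (B + 1), n c k := Finset.sum_nonneg fun c _ => hn c k
    calc N * B / (1536 * L) = N / 2 * (B / 4) * (1 / (48 * L)) / 4 := by
          field_simp; ring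
      _ ≤ (∑ c ∈ Finset.range (B + 1), n c k) * gap P j ^ 2 / 4 := by gcongr
      _ = (∑ c ∈ Finset.range (B + 1), n c k) * (gap P j ^ 2 / 4) := by ring
      _ ≤ _ := by gcongr

end Tracking

/-! ### The pulls of Almost Tracking -/

section Pulls

variable {K : ℕ}

theorem firstArm_eq [NeZero K] {p : Fin K → Prop} {i : Fin K} (hi : p i) (hlt : ∀ j < i, ¬ p j) :
    firstArm p = i := by
  classical
  have hmem : i ∈ Finset.univ.filter p := Finset.mem_filter.2 ⟨Finset.mem_univ _, hi⟩
  have hne : (Finset.univ.filter p).Nonempty := ⟨i, hmem⟩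
  rw [firstArm, dif_pos (by convert hne)]
  refine le_antisymm (Finset.min'_le _ _ (by convert hmem)) ?_
  refine Finset.le_min' _ _ _ fun j hj => ?_
  by_contra hji
  exact hlt j (not_le.1 hji) (Finset.mem_filter.1 hj).2

theorem firstArm_spec [NeZero K] {p : Fin K → Prop} (h : ∃ i, p i) : p (firstArm p) := by
  classical
  obtain ⟨i, hi⟩ := h
  have hne : (Finset.univ.filter p).Nonempty := ⟨i, Finset.mem_filter.2 ⟨Finset.mem_univ _, hi⟩⟩
  rw [firstArm, dif_pos (by convert hne)]
  exact (Finset.mem_filter.1 (Finset.min'_mem _ (by convert hne))).2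

theorem sum_basePulls_le {N : ℕ} (hN : K ≤ N) {w : Fin K → ℝ} (hw : ∀ i, 0 ≤ w i)
    (hsum : ∑ i, w i = 1) : ∑ i, basePulls N w i ≤ N := by
  classical
  set p := (Finset.univ.filter (fun j => 0 < w j)).card with hp
  have hpK : p ≤ K := (Finset.card_le_univ _).trans (by simp)
  have hpN : (p : ℝ) ≤ N := by exact_mod_cast hpK.trans hN
  have h : ∀ i, (basePulls N w i : ℝ) ≤ (if 0 < w i then 1 else 0) + w i * ((N : ℝ) - p) := by
    intro i
    have hnn : 0 ≤ w i * ((N : ℝ) - p) := mul_nonneg (hw i) (by linarith)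
    unfold basePulls
    split_ifs with hi
    · push_cast
      have := Nat.floor_le hnn
      rw [hp] at this ⊢
      convert add_le_add_right this 1
    · simpa using hnn
  have hs := Finset.sum_le_sum fun i (_ : i ∈ Finset.univ) => h i
  rw [Finset.sum_add_distrib, ← Finset.sum_mul, hsum, one_mul, Finset.sum_boole, ← hp] at hs
  have : (∑ i, (basePulls N w i : ℝ)) ≤ N := by linarith
  exact_mod_cast this

theorem sum_roundedPulls_le [NeZero K] {N : ℕ} (hN : K ≤ N) {w : Fin K → ℝ} (hw : ∀ i, 0 ≤ w i)
    (hsum : ∑ i, w i = 1) (u : ℕ → unitInterval) : ∑ i, roundedPulls N w u i ≤ N := by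
  have hb := sum_basePulls_le hN hw hsum
  unfold roundedPulls
  rw [Finset.sum_add_distrib, Finset.sum_comm]
  simp only [Finset.sum_ite_eq, Finset.mem_univ, if_true, Finset.sum_const, Finset.card_range,
    smul_eq_mul, mul_one]
  omega

theorem le_basePulls {N : ℕ} {w : Fin K → ℝ} {i : Fin K} (hw : 0 ≤ w i) :
    w i * ((N : ℝ) - K) ≤ basePulls N w i := by
  classical
  unfold basePulls
  split_ifs with hi
  · push_cast
    have hp : ((Finset.univ.filter (fun j => 0 < w j)).card : ℝ) ≤ K := by
      exact_mod_cast (Finset.card_le_univ _).trans (by simp)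
    have h1 : w i * ((N : ℝ) - K) ≤
        w i * ((N : ℝ) - ((Finset.univ.filter (fun j => 0 < w j)).card : ℝ)) := by gcongr
    have h2 := Nat.lt_floor_add_one
      (w i * ((N : ℝ) - ((Finset.univ.filter (fun j => 0 < w j)).card : ℝ)))
    rw [add_comm 1]
    refine h1.trans (h2.le.trans (le_of_eq ?_))
    congr!
  · have : w i = 0 := le_antisymm (not_lt.1 hi) hw
    simp [this]

theorem sum_truncate {β : Type*} [AddCommMonoid β] {T t m : ℕ} (ht : t ≤ T) (hm : m ≤ t)
    (f : Fin T → Prop) [DecidablePred f] (g : Fin T → β) :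
    (∑ s : Fin t, if (s : ℕ) < m ∧ f (Fin.castLE ht s) then g (Fin.castLE ht s) else 0) =
      ∑ s : Fin T, if (s : ℕ) < m ∧ f s then g s else 0 := by
  refine Fintype.sum_of_injective (Fin.castLE ht) (Fin.castLE_injective ht) _ _ ?_ (fun s => rfl)
  intro s hs
  refine if_neg fun h => hs ⟨⟨s, by omega⟩, rfl⟩

theorem empMean_truncate {T t m : ℕ} (ht : t ≤ T) (hm : m ≤ t) (h : Fin T → Fin K × ℝ) :
    empMean m (truncate h t ht) = empMean m h := by
  funext i
  unfold empMean pulls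
  have h1 := sum_truncate ht hm (fun s => (h s).1 = i) (fun s => (h s).2)
  have h2 := sum_truncate ht hm (fun s => (h s).1 = i) (fun _ => (1 : ℕ))
  exact congrArg₂ (· / ·) h1 (congrArg Nat.cast h2)

theorem cumWeights_congr {w : (Fin K → ℝ) → Fin K → ℝ} {Csuf : ℝ} {Q Q' : ℕ → Fin K → ℝ} (b : ℕ)
    (h : ∀ c < b, Q c = Q' c) : cumWeights w Csuf Q b = cumWeights w Csuf Q' b := by
  induction b with
  | zero => rfl
  | succ b ih =>
    funext i
    rw [cumWeights, cumWeights, ih fun c hc => h c (by omega), h b (by omega)]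

theorem batchWeights_congr {w : (Fin K → ℝ) → Fin K → ℝ} {Csuf : ℝ} {Q Q' : ℕ → Fin K → ℝ} (b : ℕ)
    (h : ∀ c ≤ b, Q c = Q' c) : batchWeights w Csuf Q b = batchWeights w Csuf Q' b := by
  rw [batchWeights, batchWeights, cumWeights_congr b fun c hc => h c hc.le, h b le_rfl]

/-- A history whose arms are those selected by Almost Tracking. -/
def IsTracking [NeZero K] {T : ℕ} (Csuf : ℝ) (N : ℕ) (u : ℕ × ℕ → unitInterval)
    (h : Fin T → Fin K × ℝ) : Prop :=
  ∀ s : Fin T, (h s).1 = trackingSample allocation Csuf N s (u, truncate h s s.2.le)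

/-- Within a complete batch, the rounds whose position lies between two consecutive partial sums of
the rounded pulls select arm `i`. The rounded counts total at most `N`, so none is cut off; the
randomly assigned extra pulls can only help and are discarded. -/
theorem basePulls_le_batchPulls [NeZero K] {T : ℕ} {Csuf : ℝ} {N : ℕ} (hK : 0 < K) (hN : K ≤ N)
    {u : ℕ × ℕ → unitInterval} {h : Fin T → Fin K × ℝ} (hT : IsTracking Csuf N u h) {b : ℕ}
    (hb : (b + 1) * N ≤ T) {w : Fin K → ℝ}
    (hweq : batchWeights allocation Csuf (fun c => empMean (c * N) h) b = w)
    (hw : ∀ i, 0 ≤ w i) (hsum : ∑ i, w i = 1) (i : Fin K) :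
    basePulls N w i ≤ batchPulls N h b i := by
  have hN0 : 0 < N := by omega
  set ρ := roundedPulls N w (fun r => u (b, r)) with hρ
  have hle : basePulls N w i ≤ ρ i := Nat.le_add_right _ _
  refine hle.trans ?_
  have hIic : ∀ j, ∑ l ∈ Finset.Iic j, ρ l = ∑ l ∈ Finset.Iio j, ρ l + ρ j := by
    intro j
    rw [← Finset.Iio_insert, Finset.sum_insert (by simp), add_comm]
  have hcard : ρ i = (Finset.Ico (∑ l ∈ Finset.Iio i, ρ l) (∑ l ∈ Finset.Iic i, ρ l)).card := by
    rw [Nat.card_Ico, hIic]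
    omega
  have hbp : batchPulls N h b i =
      (Finset.univ.filter (fun s : Fin T => (s : ℕ) / N = b ∧ (h s).1 = i)).card := by
    rw [batchPulls, Finset.sum_boole, Nat.cast_id]
  rw [hcard, hbp]
  refine Finset.card_le_card_of_surjOn (fun s : Fin T => (s : ℕ) % N) ?_
  intro r hr
  obtain ⟨hr1, hr2⟩ := Finset.mem_Ico.1 hr
  have htot : ∑ l ∈ Finset.Iic i, ρ l ≤ N :=
    (Finset.sum_le_sum_of_subset (Finset.subset_univ _)).trans
      (sum_roundedPulls_le hN hw hsum _)
  have hrN : r < N := lt_of_lt_of_le hr2 htot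
  have hbN : b * N + r < T := by
    rw [add_mul] at hb
    omega
  have hdiv : (b * N + r) / N = b := by
    rw [mul_comm, Nat.mul_add_div hN0, Nat.div_eq_of_lt hrN, add_zero]
  have hmod : (b * N + r) % N = r := by
    rw [mul_comm, Nat.mul_add_mod, Nat.mod_eq_of_lt hrN]
  refine ⟨⟨b * N + r, hbN⟩, ?_, hmod⟩
  simp only [Finset.coe_filter, Finset.mem_univ, true_and, Set.mem_ofPred_eq]
  refine ⟨hdiv, ?_⟩
  rw [hT]
  unfold trackingSample
  -- The sampling rule sees only the truncated history, but the weights of batch `b` use only rounds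
  -- before `b * N`, so they agree with those computed from the full history.
  have hweights : batchWeights allocation Csuf
      (fun c => empMean (c * N) (truncate h (b * N + r) hbN.le)) b = w := by
    rw [← hweq]
    refine batchWeights_congr b fun c hc => ?_
    refine empMean_truncate _ ?_ h
    have := Nat.mul_le_mul_right N hc
    omega
  simp only [hdiv, hmod]
  rw [hweights]
  refine firstArm_eq hr2 fun j hj => not_lt.2 (le_trans ?_ hr1)
  refine Finset.sum_le_sum_of_subset fun l hl => ?_
  exact Finset.mem_Iio.2 (lt_of_le_of_lt (Finset.mem_Iic.1 hl) hj)

/-! ### The weights of Almost Tracking -/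

theorem nextWeights_zero (w : (Fin K → ℝ) → Fin K → ℝ) (Csuf : ℝ) (c Q : Fin K → ℝ) (i : Fin K) :
    nextWeights w Csuf 0 c Q i = 1 / (K : ℝ) := by simp [nextWeights]

variable {Csuf : ℝ} {Q : ℕ → Fin K → ℝ}

/-- The properties of the weights of one batch. -/
theorem nextWeights_spec (hK : 2 ≤ K) (hC0 : 0 < Csuf) (hC1 : Csuf < 1) {b : ℕ} (hb : b ≠ 0)
    {c x : Fin K → ℝ} {m : Fin K} (hx : bestArms x = {m}) (hc : ∑ i, c i = b) :
    (∀ i, 0 ≤ nextWeights allocation Csuf b c x i) ∧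
    ∑ i, nextWeights allocation Csuf b c x i = 1 ∧
    ∀ i, allocation x i ≤ nextWeights allocation Csuf b c x i ∨ b * allocation x i ≤ c i := by
  classical
  have hpos := allocation_pos hK hx
  have hsum := sum_allocation hK hx
  have hb0 : (0 : ℝ) < b := by exact_mod_cast Nat.pos_of_ne_zero hb
  set I := insufficient allocation Csuf b c x with hI
  have hCs : 1 < 1 / Csuf := by rw [lt_div_iff₀ hC0]; linarith
  have hsuff : ∀ i ∉ I, 1 / Csuf * allocation x i < 1 / (b : ℝ) * c i := by
    intro i hi
    by_contra hcon
    exact hi (Finset.mem_filter.2 ⟨Finset.mem_univ _, not_lt.1 hcon⟩)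
  -- If every arm were sufficiently drawn, summing over the arms would give `1 / Csuf ≤ 1`, contrary
  -- to `Csuf < 1`.
  have hne : I.Nonempty := by
    by_contra hcon
    rw [Finset.not_nonempty_iff_eq_empty] at hcon
    have : ∑ i, 1 / Csuf * allocation x i ≤ ∑ i, 1 / (b : ℝ) * c i :=
      Finset.sum_le_sum fun i _ => (hsuff i (by simp [hcon])).le
    rw [← Finset.mul_sum, ← Finset.mul_sum, hsum, hc, one_div_mul_cancel hb0.ne'] at this
    linarith
  have hS : 0 < ∑ j ∈ I, allocation x j := Finset.sum_pos (fun j _ => hpos j) hne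
  have hS1 : ∑ j ∈ I, allocation x j ≤ 1 := by
    rw [← hsum]
    exact Finset.sum_le_sum_of_subset_of_nonneg (Finset.subset_univ _) fun j _ _ => (hpos j).le
  have heq : ∀ i, nextWeights allocation Csuf b c x i =
      if i ∈ I then allocation x i / ∑ j ∈ I, allocation x j else 0 := by
    intro i
    simp [nextWeights, hb, hI]
  refine ⟨fun i => ?_, ?_, fun i => ?_⟩
  · rw [heq]
    split_ifs
    · exact div_nonneg (hpos i).le hS.le
    · exact le_rfl
  · simp_rw [heq]
    rw [Finset.sum_ite_mem, Finset.univ_inter, ← Finset.sum_div, div_self hS.ne']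
  · rw [heq]
    split_ifs with hi
    · left
      rw [le_div_iff₀ hS]
      exact mul_le_of_le_one_right (hpos i).le hS1
    · right
      have h1 := hsuff i hi
      have h2 : allocation x i ≤ 1 / Csuf * allocation x i :=
        le_mul_of_one_le_left (hpos i).le hCs.le
      have h3 := h2.trans h1.le
      rw [one_div_mul_eq_div, le_div_iff₀ hb0] at h3
      linarith

theorem sum_cumWeights (hK : 2 ≤ K) (hC0 : 0 < Csuf) (hC1 : Csuf < 1) {B : ℕ}
    (hQ : ∀ b, 1 ≤ b → b < B → ∃ m, bestArms (Q b) = {m}) :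
    ∑ i, cumWeights allocation Csuf Q B i = B := by
  induction B with
  | zero => simp [cumWeights]
  | succ B ih =>
    have ih := ih fun b h1 h2 => hQ b h1 (by omega)
    simp only [cumWeights]
    rw [Finset.sum_add_distrib, ih]
    push_cast
    congr 1
    rcases Nat.eq_zero_or_pos B with rfl | hB
    · have : (K : ℝ) ≠ 0 := by positivity
      simp [nextWeights_zero, this]
    · obtain ⟨m, hm⟩ := hQ B hB (by omega)
      exact (nextWeights_spec hK hC0 hC1 hB.ne' hm ih).2.1

theorem batchWeights_prob (hK : 2 ≤ K) (hC0 : 0 < Csuf) (hC1 : Csuf < 1) {b : ℕ}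
    (hQ : ∀ c, 1 ≤ c → c ≤ b → ∃ m, bestArms (Q c) = {m}) :
    (∀ i, 0 ≤ batchWeights allocation Csuf Q b i) ∧
      ∑ i, batchWeights allocation Csuf Q b i = 1 := by
  unfold batchWeights
  rcases Nat.eq_zero_or_pos b with rfl | hb
  · have : (K : ℝ) ≠ 0 := by positivity
    simp [nextWeights_zero, this]
  · obtain ⟨m, hm⟩ := hQ b hb le_rfl
    have := nextWeights_spec hK hC0 hC1 hb.ne' hm
      (sum_cumWeights hK hC0 hC1 fun c h1 h2 => hQ c h1 h2.le)
    exact ⟨this.1, this.2.1⟩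

theorem allocation_le_batchWeights_or (hK : 2 ≤ K) (hC0 : 0 < Csuf) (hC1 : Csuf < 1) {b : ℕ}
    (hb : 1 ≤ b) (hQ : ∀ c, 1 ≤ c → c ≤ b → ∃ m, bestArms (Q c) = {m}) (i : Fin K) :
    allocation (Q b) i ≤ batchWeights allocation Csuf Q b i ∨
      b * allocation (Q b) i ≤ cumWeights allocation Csuf Q b i := by
  obtain ⟨m, hm⟩ := hQ b hb le_rfl
  exact (nextWeights_spec hK hC0 hC1 (by omega) hm
    (sum_cumWeights hK hC0 hC1 fun c h1 h2 => hQ c h1 h2.le)).2.2 i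

/-- Allocations never fall below `1/K²`, so at each batch an arm either gains that much or already
holds `b / K² ≥ (b+1) / (2K²)`. This guarantees that after order `K²` batches the past pulls of
every arm dominate any single batch. -/
theorem le_cumWeights (hK : 2 ≤ K) (hC0 : 0 < Csuf) (hC1 : Csuf < 1) {b : ℕ} (hb : 1 ≤ b)
    (hQ : ∀ c, 1 ≤ c → c < b → ∃ m, bestArms (Q c) = {m}) (i : Fin K) :
    b / (2 * (K : ℝ) ^ 2) ≤ cumWeights allocation Csuf Q b i := by
  have hK0 : (2 : ℝ) ≤ K := by exact_mod_cast hK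
  induction b, hb using Nat.le_induction with
  | base =>
    simp only [cumWeights, nextWeights_zero, zero_add, Nat.cast_one]
    refine one_div_le_one_div_of_le (by positivity) ?_
    nlinarith
  | succ b hb ih =>
    have ih := ih fun c h1 h2 => hQ c h1 (by omega)
    obtain ⟨m, hm⟩ := hQ b hb (by omega)
    have hl := le_allocation hK hm i
    have hw := (batchWeights_prob hK hC0 hC1 (Q := Q) (b := b)
      fun c h1 h2 => hQ c h1 (by omega)).1 i
    have ht := allocation_le_batchWeights_or hK hC0 hC1 (Q := Q) hb
      (fun c h1 h2 => hQ c h1 (by omega)) i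
    have hcum : cumWeights allocation Csuf Q (b + 1) i =
      cumWeights allocation Csuf Q b i + batchWeights allocation Csuf Q b i := rfl
    rw [hcum]
    have e1 : ((b + 1 : ℕ) : ℝ) / (2 * (K : ℝ) ^ 2) =
        b / (2 * (K : ℝ) ^ 2) + 1 / (K : ℝ) ^ 2 / 2 := by push_cast; ring
    have e2 : (b : ℝ) / (2 * (K : ℝ) ^ 2) = b * (1 / (K : ℝ) ^ 2) / 2 := by ring
    have hpos : 0 < 1 / (K : ℝ) ^ 2 := by positivity
    have hb1 : (1 : ℝ) ≤ b := by exact_mod_cast hb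
    rcases ht with ht | ht
    · linarith
    · have h1 : (b : ℝ) * (1 / (K : ℝ) ^ 2) ≤ b * allocation (Q b) i := by gcongr
      nlinarith

theorem cumWeights_eq_sum (b : ℕ) (i : Fin K) :
    cumWeights allocation Csuf Q b i =
      ∑ c ∈ Finset.range b, batchWeights allocation Csuf Q c i := by
  induction b with
  | zero => simp [cumWeights]
  | succ b ih => rw [Finset.sum_range_succ, ← ih]; rfl

/-! ### The deviation forced by an error -/

theorem sum_batch {β : Type*} [AddCommMonoid β] {T N : ℕ} (hN : 0 < N) (b : ℕ)
    (f : Fin T → Prop) [DecidablePred f] (g : Fin T → β) :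
    ∑ c ∈ Finset.range b, ∑ s : Fin T, (if (s : ℕ) / N = c ∧ f s then g s else 0) =
      ∑ s : Fin T, if (s : ℕ) < b * N ∧ f s then g s else 0 := by
  rw [Finset.sum_comm]
  refine Finset.sum_congr rfl fun s _ => ?_
  simp_rw [ite_and]
  rw [Finset.sum_ite_eq]
  simp only [Finset.mem_range, Nat.div_lt_iff_lt_mul hN]

theorem sum_batchPulls {T N : ℕ} (hN : 0 < N) (h : Fin T → Fin K × ℝ) (b : ℕ) (i : Fin K) :
    ∑ c ∈ Finset.range b, batchPulls N h c i = pulls h (b * N) i :=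
  sum_batch hN b (fun s => (h s).1 = i) (fun _ => 1)

theorem sum_batchDev {T N : ℕ} (hN : 0 < N) (P : Fin K → ℝ) (h : Fin T → Fin K × ℝ) (b : ℕ)
    (i : Fin K) :
    ∑ c ∈ Finset.range b, batchDev N P h c i =
      rewardSum h (b * N) i - P i * pulls h (b * N) i := by
  refine (sum_batch hN b (fun s => (h s).1 = i) (fun s => (h s).2 - P i)).trans ?_
  unfold rewardSum pulls
  push_cast
  rw [Finset.mul_sum, ← Finset.sum_sub_distrib]
  refine Finset.sum_congr rfl fun s _ => ?_
  split_ifs <;> simp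

theorem empMean_sub_eq {T N : ℕ} (hN : 0 < N) (P : Fin K → ℝ) (h : Fin T → Fin K × ℝ) (b : ℕ)
    (i : Fin K) (hpos : 0 < pulls h (b * N) i) :
    empMean (b * N) h i - P i = (∑ c ∈ Finset.range b, batchDev N P h c i) /
      (∑ c ∈ Finset.range b, (batchPulls N h c i : ℝ)) := by
  have h1 : (∑ c ∈ Finset.range b, (batchPulls N h c i : ℝ)) = pulls h (b * N) i := by
    exact_mod_cast sum_batchPulls hN h b i
  have hp : (pulls h (b * N) i : ℝ) ≠ 0 := by exact_mod_cast hpos.ne'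
  rw [h1, sum_batchDev hN, sub_div, mul_div_cancel_right₀ _ hp]
  rfl

theorem empMean_of_le {T m : ℕ} (h : Fin T → Fin K × ℝ) (hm : T ≤ m) :
    empMean m h = empMean T h := by
  funext i
  have : ∀ s : Fin T, ((s : ℕ) < m ∧ (h s).1 = i) ↔ ((s : ℕ) < T ∧ (h s).1 = i) := fun s =>
    and_congr_left fun _ => ⟨fun _ => s.2, fun h => by omega⟩
  simp [empMean, pulls, this]

theorem bestArms_eq_singleton [NeZero K] {x : Fin K → ℝ} (hx : ∀ i j, i ≠ j → x i ≠ x j) :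
    ∃ m, bestArms x = {m} := by
  obtain ⟨m, hm⟩ := Finite.exists_max x
  refine ⟨m, Finset.ext fun i => ?_⟩
  rw [Finset.mem_singleton, bestArms, Finset.mem_filter]
  refine ⟨fun h => ?_, fun h => ⟨Finset.mem_univ _, fun j => h ▸ hm j⟩⟩
  by_contra hne
  exact hx i m hne (le_antisymm (hm i) (h.2 m))

theorem empiricalBest_mem [NeZero K] {T : ℕ} (h : Fin T → Fin K × ℝ) :
    empiricalBest h ∈ bestArms (empMean T h) := by
  refine firstArm_spec ?_
  obtain ⟨m, hm⟩ := Finite.exists_max (empMean T h)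
  exact ⟨m, Finset.mem_filter.2 ⟨Finset.mem_univ _, hm⟩⟩

/-- Converts the mixture normalization `2(n+1)` to the form `S² ≤ n e` of the deterministic part.
The factor 4 suffices because `n + 1 ≤ 2n` once `n ≥ 1`; with no pulls the sum is zero. -/
theorem batchDev_sq_le {T N : ℕ} (P : Fin K → ℝ) (h : Fin T → Fin K × ℝ) (b : ℕ) (i : Fin K) :
    batchDev N P h b i ^ 2 ≤ batchPulls N h b i *
      (4 * (batchDev N P h b i ^ 2 / (2 * (batchPulls N h b i + 1)))) := by
  rcases Nat.eq_zero_or_pos (batchPulls N h b i) with h0 | h0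
  · have hz : batchDev N P h b i = 0 := by
      unfold batchPulls at h0
      refine Finset.sum_eq_zero fun s hs => ?_
      have := Finset.sum_eq_zero_iff.1 h0 s hs
      by_cases hc : (s : ℕ) / N = b ∧ (h s).1 = i
      · simp [hc] at this
      · exact if_neg hc
    simp [h0, hz]
  · have h1 : (1 : ℝ) ≤ batchPulls N h b i := by exact_mod_cast h0
    set n : ℝ := (batchPulls N h b i : ℝ)
    set x := batchDev N P h b i ^ 2 with hx
    have hx0 : 0 ≤ x := sq_nonneg _
    have : n * (4 * (x / (2 * (n + 1)))) = x * (2 * n / (n + 1)) := by field_simp; ring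
    rw [this]
    refine le_mul_of_one_le_right hx0 ?_
    rw [le_div_iff₀ (by linarith)]
    linarith

/-- A wrong recommendation of Almost Tracking forces a large deviation. -/
theorem le_deviation_of_error [NeZero K] (hK : 2 ≤ K) {P : Fin K → ℝ} {a : Fin K}
    (hP : bestArms P = {a}) (hC0 : 0 < Csuf) (hC1 : Csuf < 1) {T N : ℕ} (hN : 2 * K ≤ N)
    (hB : 16 * K ^ 2 ≤ T / N) {u : ℕ × ℕ → unitInterval} {h : Fin T → Fin K × ℝ}
    (hT : IsTracking Csuf N u h)
    (hties : ∀ m ≤ T, ∀ i j, i ≠ j → 0 < pulls h m i → 0 < pulls h m j →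
      empMean m h i ≠ empMean m h j)
    (herr : empiricalBest h ≠ a) :
    N * (T / N : ℕ) / (196608 * (riskH1 P * Real.log K)) ≤ deviation N (T / N + 1) P h := by
  set B := T / N with hBdef
  have hN0 : 0 < N := by omega
  have hBT : B * N ≤ T := Nat.div_mul_le_self T N
  have hbT : ∀ b ≤ B, b * N ≤ T := fun b hb => (Nat.mul_le_mul_right N hb).trans hBT
  have hTB : T < (B + 1) * N := by
    have := Nat.lt_mul_div_succ T hN0
    rw [mul_comm]; exact this
  have hK4 : 4 ≤ K ^ 2 := by nlinarith
  set Q : ℕ → Fin K → ℝ := fun b => empMean (b * N) h with hQdef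
  have hpos1 : ∀ i, 0 < batchPulls N h 0 i := by
    intro i
    have hw := batchWeights_prob hK hC0 hC1 (Q := Q) (b := 0) (fun c h1 h2 => by omega)
    refine lt_of_lt_of_le ?_ (basePulls_le_batchPulls (by omega) (by omega) hT
      (by simpa using hbT 1 (by omega)) rfl hw.1 hw.2 i)
    have : 0 < batchWeights allocation Csuf Q 0 i := by
      unfold batchWeights
      rw [nextWeights_zero]
      positivity
    rw [basePulls, if_pos this]
    omega
  have hppos : ∀ b, 1 ≤ b → ∀ i, 0 < pulls h (b * N) i := by
    intro b hb i
    rw [← sum_batchPulls hN0]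
    exact lt_of_lt_of_le (hpos1 i) (Finset.single_le_sum (f := fun c => batchPulls N h c i)
      (fun c _ => Nat.zero_le _) (Finset.mem_range.2 (by omega : 0 < b)))
  have hQ : ∀ b, 1 ≤ b → b ≤ B → ∃ m, bestArms (Q b) = {m} := fun b h1 h2 =>
    bestArms_eq_singleton fun i j hij =>
      hties (b * N) (hbT b h2) i j hij (hppos b h1 i) (hppos b h1 j)
  have hNK : (N : ℝ) / 2 ≤ N - K := by
    have : 2 * (K : ℝ) ≤ N := by exact_mod_cast hN
    linarith
  have hbatch : ∀ b, b < B → ∀ i,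
      N / 2 * batchWeights allocation Csuf Q b i ≤ batchPulls N h b i := by
    intro b hb i
    have hw := batchWeights_prob hK hC0 hC1 (Q := Q) (b := b) (fun c h1 h2 => hQ c h1 (by omega))
    have h1 := basePulls_le_batchPulls (by omega) (by omega) hT (hbT (b + 1) hb) rfl hw.1 hw.2 i
    have h2 := le_basePulls (N := N) (hw.1 i)
    have h3 : (basePulls N (batchWeights allocation Csuf Q b) i : ℝ) ≤ batchPulls N h b i := by
      exact_mod_cast h1
    refine le_trans ?_ (h2.trans h3)
    rw [mul_comm]
    exact mul_le_mul_of_nonneg_left hNK (hw.1 i)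
  have hcum : ∀ b, b ≤ B → ∀ i, N / 2 * cumWeights allocation Csuf Q b i ≤
      ∑ c ∈ Finset.range b, (batchPulls N h c i : ℝ) := by
    intro b hb i
    rw [cumWeights_eq_sum, Finset.mul_sum]
    exact Finset.sum_le_sum fun c hc => hbatch c (by have := Finset.mem_range.1 hc; omega) i
  have hsumpos : ∀ b, 1 ≤ b → ∀ i, 0 < ∑ c ∈ Finset.range b, (batchPulls N h c i : ℝ) := by
    intro b hb i
    have := hppos b hb i
    rw [← sum_batchPulls hN0] at this
    exact_mod_cast this
  -- The window starts at the rounded-up quarter of `B`: late enough that `b ≥ B/4`, early enough to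
  -- keep half of the batches.
  have main := le_total_deviation hK hP (N := N) (Nat.cast_nonneg N) (b₀ := (B + 3) / 4) (B := B)
    (by omega) (by omega) (n := fun b k => batchPulls N h b k) (S := fun b k => batchDev N P h b k)
    (e := fun b k => 4 * (batchDev N P h b k ^ 2 / (2 * (batchPulls N h b k + 1)))) (Q := Q)
    (fun b k => Nat.cast_nonneg _) (fun b k => by positivity)
    (fun b k => batchDev_sq_le P h b k)
    (fun b h1 h2 => hQ b (by omega) h2.le)
    (fun b h1 h2 k => empMean_sub_eq hN0 P h b k (hppos b (by omega) k))
    (fun b h1 h2 k => ⟨hsumpos b (by omega) k, ?_⟩)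
    (fun b h1 h2 k => ?_) ?_
  · have e : ∑ b ∈ Finset.range (B + 1), ∑ k,
        4 * (batchDev N P h b k ^ 2 / (2 * ((batchPulls N h b k : ℝ) + 1)))
        = 4 * deviation N (B + 1) P h := by
      unfold deviation
      rw [Finset.sum_product, Finset.mul_sum]
      exact Finset.sum_congr rfl fun b _ => (Finset.mul_sum _ _ _).symm
    rw [e] at main
    have e2 : (N : ℝ) * B / (196608 * (riskH1 P * Real.log K)) =
        N * B / (49152 * (riskH1 P * Real.log K)) / 4 := by
      rw [div_div]; ring_nf
    rw [e2]
    linarith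
  -- Here `B ≥ 16 K²` gives `b ≥ 4 K²`, hence cumulative weight at least 2 and at least `N` past
  -- pulls.
  · have h3 : (batchPulls N h b k : ℝ) ≤ N := by exact_mod_cast batchPulls_le hN0 h b k
    refine h3.trans (le_trans ?_ (hcum b h2.le k))
    have h4 := le_cumWeights hK hC0 hC1 (Q := Q) (b := b) (by omega)
      (fun c h5 h6 => hQ c h5 (by omega)) k
    have h5 : (2 : ℝ) ≤ b / (2 * (K : ℝ) ^ 2) := by
      rw [le_div_iff₀ (by positivity)]
      have : 4 * K ^ 2 ≤ b := by omega
      have : 4 * (K : ℝ) ^ 2 ≤ b := by exact_mod_cast this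
      linarith
    have h6 : (0 : ℝ) ≤ N := Nat.cast_nonneg N
    nlinarith
  · rcases allocation_le_batchWeights_or hK hC0 hC1 (Q := Q) (b := b) (by omega)
      (fun c h5 h6 => hQ c h5 (by omega)) k with h3 | h3
    · left
      refine le_trans ?_ (hbatch b h2 k)
      gcongr
    · right
      refine le_trans ?_ (hcum b h2.le k)
      rw [mul_assoc]
      gcongr
  · have hJ := (Finset.mem_filter.1 (empiricalBest_mem h)).2 a
    obtain ⟨k, hk, hgap⟩ := exists_half_gap_le hP hJ
    refine ⟨empiricalBest h, k, hk, herr, ?_⟩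
    -- The possibly incomplete last batch has index `B`, so the recommendation uses the averages
    -- over `B + 1` batches.
    have := empMean_sub_eq hN0 P h (B + 1) k (hppos (B + 1) (by omega) k)
    rw [← this, empMean_of_le h hTB.le]
    exact hgap

end Pulls

/-! ### The rate of Almost Tracking -/

section Rate

variable {K : ℕ} [NeZero K]

theorem probError_almostTracking_le (hK : 2 ≤ K) {ν : Fin K → Measure ℝ}
    (hν : ∀ i, ν i ∈ subGaussianLaws) {a : Fin K} (ha : bestArms (means ν) = {a}) {Csuf : ℝ}
    (hC0 : 0 < Csuf) (hC1 : Csuf < 1) {T N : ℕ} (hN : 2 * K ≤ N) (hB : 16 * K ^ 2 ≤ T / N) :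
    probError (almostTracking (K := K) allocation measurable_allocation Csuf N T) ν ≤
      ENNReal.ofReal ((N + 1) ^ ((T / N + 1) * K) *
        Real.exp (-(N * (T / N : ℕ) / (196608 * (riskH1 (means ν) * Real.log K))))) := by
  have hprob : ∀ i, IsProbabilityMeasure (ν i) := fun i => (hν i).1
  set A := almostTracking (K := K) allocation measurable_allocation Csuf N T with hA
  refine le_trans (measure_mono_ae ?_)
    (measure_deviation_ge_le A ν hν (by omega : 0 < N) (T / N + 1) T _)
  have h1 := ae_sampled A ν T
  have h2 : ∀ᵐ p ∂historyLaw A ν T, ∀ m i j, i ≠ j → 0 < pulls p.2 m i → 0 < pulls p.2 m j →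
      empMean m p.2 i ≠ empMean m p.2 j := by
    rw [ae_all_iff]; intro m
    rw [ae_all_iff]; intro i
    rw [ae_all_iff]; intro j
    by_cases hij : i = j
    · exact ae_of_all _ fun p h => absurd hij h
    · filter_upwards [ae_empMean_ne A ν (fun i => (hν i).2.1) m hij T] with p hp _ using hp
  filter_upwards [h1, h2] with p hp1 hp2 herr
  refine le_deviation_of_error hK ha hC0 hC1 hN hB (u := p.1) hp1
    (fun m _ => hp2 m) fun h => ?_
  have herr : empiricalBest p.2 ∉ bestArms (means ν) := herr
  rw [ha, h] at herr
  simp at herr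

theorem le_log_inv_of_le_ofReal_exp {x : ENNReal} {z : ℝ} (h : x ≤ ENNReal.ofReal (Real.exp (-z))) :
    (z : EReal) ≤ ENNReal.log x⁻¹ := by
  have h1 : ENNReal.ofReal (Real.exp z) ≤ x⁻¹ := by
    rw [ENNReal.le_inv_iff_le_inv, ← ENNReal.ofReal_inv_of_pos (Real.exp_pos z), ← Real.exp_neg]
    exact h
  have h2 := ENNReal.log_monotone h1
  rwa [ENNReal.log_ofReal_of_pos (Real.exp_pos z), Real.log_exp] at h2

theorem tendsto_rate_lower_bound {N : ℕ → ℕ} (c d : ℝ)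
    (h1 : Tendsto (fun T => (N T : ℝ)) atTop atTop)
    (h2 : Tendsto (fun T => (N T : ℝ) / T) atTop (nhds 0)) :
    Tendsto (fun T : ℕ => c * (1 - (N T : ℝ) / T) - d * (Real.log (N T + 1) / (N T + 1)))
      atTop (nhds c) := by
  have h3 : Tendsto (fun T => Real.log (N T + 1) / (N T + 1)) atTop (nhds 0) :=
    (Real.isLittleO_log_id_atTop.tendsto_div_nhds_zero).comp (tendsto_atTop_add_const_right _ 1 h1)
  have := ((h2.const_sub 1).const_mul c).sub (h3.const_mul d)
  simpa using this

theorem le_rate_almostTracking (hK : 2 ≤ K) {D : Set (Measure ℝ)} (hD : D ⊆ subGaussianLaws)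
    {Csuf : ℝ} (hC0 : 0 < Csuf) (hC1 : Csuf < 1) {N : ℕ → ℕ}
    (hN : Tendsto (fun T => (N T : ℝ)) atTop atTop)
    (hNT : Tendsto (fun T => (N T : ℝ) / T) atTop (nhds 0)) :
    ((1 / 196608 / Real.log K : ℝ) : EReal) ≤ rate riskH1 D
      (fun T => almostTracking (K := K) allocation measurable_allocation Csuf (N T) T) := by
  have hlog : 0 < Real.log K := Real.log_pos (by exact_mod_cast hK)
  unfold rate
  refine le_iInf fun ν => le_iInf fun hν => le_iInf fun hcard => ?_
  obtain ⟨a, ha⟩ := Finset.card_eq_one.1 hcard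
  have hν : ∀ i, ν i ∈ subGaussianLaws := fun i => hD (hν i)
  have hH := riskH1_pos hK ha
  set H := riskH1 (means ν)
  set c : ℝ := 1 / (196608 * (H * Real.log K)) with hc
  have hc0 : 0 < c := by positivity
  have hlim : ((c : ℝ) : EReal) ≤ liminf (fun T : ℕ => ENNReal.log (probError
      (almostTracking (K := K) allocation measurable_allocation Csuf (N T) T) ν)⁻¹ / (T : EReal))
      atTop := by
    have hφ := (continuous_coe_real_ereal.tendsto c).comp
      (tendsto_rate_lower_bound c (4 * K) hN hNT)
    rw [← hφ.liminf_eq]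
    refine liminf_le_liminf ?_
    have e1 : ∀ᶠ T in atTop, ((2 * K : ℕ) : ℝ) ≤ N T := hN.eventually_ge_atTop _
    have e2 : ∀ᶠ T : ℕ in atTop, (N T : ℝ) / T < 1 / (16 * K ^ 2 + 1) :=
      hNT.eventually_lt_const (by positivity)
    filter_upwards [e1, e2, eventually_gt_atTop 0] with T e1 e2 hT
    have e1 : 2 * K ≤ N T := by exact_mod_cast e1
    have hN0 : 0 < N T := by omega
    have hT0 : (0 : ℝ) < T := by exact_mod_cast hT
    have hN0' : (0 : ℝ) < N T := by exact_mod_cast hN0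
    have e3 : (16 * K ^ 2 + 1) * N T ≤ T := by
      rw [div_lt_div_iff₀ hT0 (by positivity)] at e2
      have : (((16 * K ^ 2 + 1) * N T : ℕ) : ℝ) < T := by push_cast; linarith
      exact_mod_cast this.le
    have hB : 16 * K ^ 2 ≤ T / N T := by
      rw [Nat.le_div_iff_mul_le hN0]
      nlinarith
    have hp := probError_almostTracking_le hK hν ha hC0 hC1 e1 hB
    set B := T / N T with hBdef
    -- The negative logarithm of the error bound: a main term of order `T` minus the cost of the
    -- mixture prefactor.
    set z : ℝ := N T * (B : ℕ) / (196608 * (H * Real.log K)) - (B + 1) * K * Real.log (N T + 1)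
      with hz
    have hp' : probError (almostTracking (K := K) allocation measurable_allocation Csuf (N T) T) ν
        ≤ ENNReal.ofReal (Real.exp (-z)) := by
      refine hp.trans (le_of_eq (congrArg _ ?_))
      rw [← Real.exp_log (show (0 : ℝ) < (N T + 1) ^ ((B + 1) * K) by positivity), ← Real.exp_add,
        Real.log_pow]
      congr 1
      rw [hz]
      push_cast
      ring
    have hzT : c * (1 - (N T : ℝ) / T) - 4 * K * (Real.log (N T + 1) / (N T + 1)) ≤ z / T := by
      have hNT' : (N T : ℝ) ≤ T := by
        have : N T ≤ T := by nlinarith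
        exact_mod_cast this
      have hl0 : 0 ≤ Real.log ((N T : ℝ) + 1) := Real.log_nonneg (by linarith)
      have hN1 : (1 : ℝ) ≤ N T := by exact_mod_cast hN0
      have hBle : (B : ℝ) * N T ≤ T := by exact_mod_cast Nat.div_mul_le_self T (N T)
      have hBge : (T : ℝ) - N T ≤ N T * B := by
        have := Nat.lt_mul_div_succ T hN0
        have : (T : ℝ) < N T * (B + 1) := by exact_mod_cast this
        linarith
      have k1 : c * (1 - (N T : ℝ) / T) ≤ c * (N T * B) / T := by
        rw [one_sub_div hT0.ne', mul_div_assoc]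
        gcongr
      have k2 : (B + 1) * K * Real.log (N T + 1) / T ≤
          4 * K * (Real.log (N T + 1) / (N T + 1)) := by
        rw [div_le_iff₀ hT0, mul_div_assoc', div_mul_eq_mul_div, le_div_iff₀ (by linarith)]
        -- Each of the four terms `BN`, `B`, `N` and `1` is at most `T`.
        have k3 : ((B : ℝ) + 1) * (N T + 1) ≤ 4 * T := by nlinarith
        calc ((B : ℝ) + 1) * K * Real.log (N T + 1) * (N T + 1)
            = K * Real.log (N T + 1) * ((B + 1) * (N T + 1)) := by ring
          _ ≤ K * Real.log (N T + 1) * (4 * T) := by gcongr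
          _ = _ := by ring
      have k4 : z / T = c * (N T * B) / T - (B + 1) * K * Real.log (N T + 1) / T := by
        rw [hz, hc, sub_div]
        congr 1
        ring
      rw [k4]
      linarith
    calc ((c * (1 - (N T : ℝ) / T) - 4 * K * (Real.log (N T + 1) / (N T + 1)) : ℝ) : EReal)
        ≤ ((z / T : ℝ) : EReal) := by exact_mod_cast hzT
      _ = (z : EReal) / (T : EReal) := by rw [EReal.coe_div]; rfl
      _ ≤ _ := EReal.div_le_div_right_of_nonneg (by positivity) (le_log_inv_of_le_ofReal_exp hp')
  calc ((1 / 196608 / Real.log K : ℝ) : EReal) = (H : EReal) * (c : EReal) := by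
        rw [← EReal.coe_mul]
        congr 1
        rw [hc]
        field_simp
    _ ≤ _ := by
        have : (0 : EReal) ≤ H := by exact_mod_cast hH.le
        gcongr

end Rate

/-! ### Change of measure -/

section ChangeOfMeasure

variable {K T : ℕ}

/-- The product of the values of `g` at the rewards of arm `i`. -/
noncomputable def armProd {t : ℕ} (i : Fin K) (g : ℝ → ENNReal) (h : Fin t → Fin K × ℝ) : ENNReal :=
  ∏ s : Fin t, if (h s).1 = i then g (h s).2 else 1

theorem measurable_armProd {t : ℕ} (i : Fin K) {g : ℝ → ENNReal} (hg : Measurable g) :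
    Measurable (fun h : Fin t → Fin K × ℝ => armProd i g h) := by
  unfold armProd
  refine Finset.measurable_prod _ fun s _ => Measurable.ite ?_ (by fun_prop) measurable_const
  exact (measurable_fst.comp (measurable_pi_apply s)) (measurableSet_singleton i)

theorem armProd_snoc {t : ℕ} (i : Fin K) (g : ℝ → ENNReal) (h : Fin t → Fin K × ℝ) (a : Fin K)
    (x : ℝ) : armProd i g (Fin.snoc (α := fun _ => Fin K × ℝ) h (a, x)) =
      armProd i g h * if a = i then g x else 1 := by
  simp [armProd, Fin.prod_univ_castSucc]

variable (A : Algorithm K T) {ν ν' : Fin K → Measure ℝ} [∀ i, IsProbabilityMeasure (ν i)]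
  [∀ i, IsProbabilityMeasure (ν' i)] {i : Fin K} {g : ℝ → ENNReal}

/-- The seed and the sampling rule are the same under both instances, so the likelihood ratio of a
history is the product of the densities at the rewards of arm `i` alone. -/
theorem lintegral_historyLaw_eq_mul (hg : Measurable g) (hi : ν i = (ν' i).withDensity g)
    (hne : ∀ j, j ≠ i → ν j = ν' j) (t : ℕ) {f : A.Seed × (Fin t → Fin K × ℝ) → ENNReal}
    (hf : Measurable f) :
    ∫⁻ p, f p ∂historyLaw A ν t = ∫⁻ p, f p * armProd i g p.2 ∂historyLaw A ν' t := by
  induction t with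
  | zero => simp [armProd, historyLaw]
  | succ t ih =>
    have hm : Measurable fun q : (A.Seed × (Fin t → Fin K × ℝ)) × ℝ => f (extend A t q.1 q.2) :=
      hf.comp (measurable_extend A t)
    rw [lintegral_historyLaw_succ A ν t hf,
      lintegral_historyLaw_succ A ν' t (f := fun p => f p * armProd i g p.2)
        (hf.mul ((measurable_armProd i hg).comp measurable_snd)),
      ih (measurable_lintegral_sample A ν t hm)]
    refine lintegral_congr fun p => ?_
    have hmx : Measurable fun x => f (extend A t p x) := hm.comp measurable_prodMk_left
    have hsplit : ∀ x, f (extend A t p x) * armProd i g (extend A t p x).2 =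
        f (extend A t p x) * (if A.sample t p = i then g x else 1) * armProd i g p.2 := by
      intro x
      simp only [extend, armProd_snoc]
      ring
    simp_rw [hsplit]
    by_cases ha : A.sample t p = i
    · simp only [ha, if_true]
      rw [lintegral_mul_const (f := fun x => f (extend A t p x) * g x) _ (hmx.mul hg), hi, lintegral_withDensity_eq_lintegral_mul _ hg hmx]
      simp only [Pi.mul_apply, mul_comm]
    · simp only [ha, if_false, mul_one]
      rw [lintegral_mul_const _ hmx, hne _ ha]

theorem lintegral_armProd_le (hg : Measurable g) (hi : ∫⁻ x, g x ∂ν i ≤ 1) (t : ℕ) :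
    ∫⁻ p, armProd i g p.2 ∂historyLaw A ν t ≤ 1 := by
  induction t with
  | zero =>
    have := isProbabilityMeasure_historyLaw A ν 0
    simp [armProd]
  | succ t ih =>
    rw [lintegral_historyLaw_succ A ν t (f := fun p => armProd i g p.2)
      ((measurable_armProd i hg).comp measurable_snd)]
    refine (lintegral_mono fun p => ?_).trans ih
    by_cases ha : A.sample t p = i
    · simp only [extend, armProd_snoc, ha, if_true]
      rw [lintegral_const_mul _ hg]
      exact mul_le_of_le_one_right zero_le hi
    · simp [extend, armProd_snoc, ha]

/-- With `c` bounding the second moment of `g`, the function `q` has mean at most 1. The squared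
likelihood ratio is then a supermartingale times `c` to the number of pulls, which is controlled
when arm `i` is pulled rarely. -/
theorem armProd_sq {t : ℕ} (i : Fin K) (g : ℝ → ENNReal) {c : ENNReal} {q : ℝ → ENNReal}
    (hq : ∀ x, g x ^ 2 = q x * c) (h : Fin t → Fin K × ℝ) :
    armProd i g h ^ 2 = armProd i q h * c ^ pulls h t i := by
  unfold armProd pulls
  rw [← Finset.prod_pow, ← Finset.prod_pow_eq_pow_sum, ← Finset.prod_mul_distrib]
  refine Finset.prod_congr rfl fun s _ => ?_
  by_cases hs : (h s).1 = i
  · simp [hs, hq]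
  · simp [hs]

/-- Comparison of the probabilities of an event on which arm `i` is pulled few times, under two
instances that differ in arm `i` only. -/
theorem eight_mul_measure_le (hg : Measurable g) (hi : ν i = (ν' i).withDensity g)
    (hne : ∀ j, j ≠ i → ν j = ν' j) {d : ℝ} (hd : 0 ≤ d)
    (hsq : ∫⁻ x, g x ^ 2 ∂ν' i ≤ ENNReal.ofReal (Real.exp d)) (t : ℕ) {n : ℝ}
    {E : Set (A.Seed × (Fin t → Fin K × ℝ))} (hE : MeasurableSet E)
    (hn : ∀ p ∈ E, (pulls p.2 t i : ℝ) ≤ n) :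
    8 * historyLaw A ν t E ≤
      64 * ENNReal.ofReal (Real.exp (d * n)) * historyLaw A ν' t E + 1 := by
  set c := ENNReal.ofReal (Real.exp d) with hc
  set e := ENNReal.ofReal (Real.exp (d * n)) with he
  have hc0 : c ≠ 0 := by rw [hc]; exact (ENNReal.ofReal_pos.2 (Real.exp_pos d)).ne'
  have hct : c ≠ ⊤ := ENNReal.ofReal_ne_top
  have he0 : e ≠ 0 := by rw [he]; exact (ENNReal.ofReal_pos.2 (Real.exp_pos _)).ne'
  have het : e ≠ ⊤ := ENNReal.ofReal_ne_top
  set q : ℝ → ENNReal := fun x => g x ^ 2 * c⁻¹ with hq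
  have hqc : ∀ x, g x ^ 2 = q x * c := fun x => by
    rw [hq, mul_assoc, ENNReal.inv_mul_cancel hc0 hct, mul_one]
  have hqm : Measurable q := (hg.pow_const 2).mul_const _
  have hq1 : ∫⁻ x, q x ∂ν' i ≤ 1 := by
    rw [lintegral_mul_const _ (hg.pow_const 2), ← ENNReal.mul_inv_cancel hc0 hct]
    gcongr
  have hind : Measurable (E.indicator (1 : A.Seed × (Fin t → Fin K × ℝ) → ENNReal)) :=
    measurable_one.indicator hE
  rw [← lintegral_indicator_one hE, lintegral_historyLaw_eq_mul A hg hi hne t hind,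
    ← lintegral_const_mul (f := fun p => E.indicator 1 p * armProd i g p.2) _
      (hind.mul ((measurable_armProd i hg).comp measurable_snd))]
  calc ∫⁻ p, 8 * (E.indicator 1 p * armProd i g p.2) ∂historyLaw A ν' t
      ≤ ∫⁻ p, (64 * e * E.indicator 1 p + armProd i q p.2) ∂historyLaw A ν' t := by
        refine lintegral_mono fun p => ?_
        by_cases hp : p ∈ E
        · simp only [Set.indicator_of_mem hp, Pi.one_apply, one_mul, mul_one]
          set L := armProd i g p.2 with hL
          -- Truncation of the likelihood ratio at `8e`. Below it, the measure under `ν'` pays;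
          -- above it, `8 L e ≤ L²` and the second moment bounds the contribution by `armProd i q`.
          by_cases hLM : L ≤ 8 * e
          · calc 8 * L ≤ 8 * (8 * e) := by gcongr
              _ = 64 * e := by rw [← mul_assoc]; norm_num
              _ ≤ _ := le_self_add
          · have hLM := (not_le.1 hLM).le
            have hpow : c ^ pulls p.2 t i ≤ e := by
              rw [hc, ← ENNReal.ofReal_pow (Real.exp_pos d).le, ← Real.exp_nat_mul, he]
              refine ENNReal.ofReal_le_ofReal (Real.exp_le_exp.2 ?_)
              have := hn p hp
              rw [mul_comm d]
              gcongr
            have h1 : 8 * L * e ≤ armProd i q p.2 * e := by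
              calc 8 * L * e = (8 * e) * L := by ring
                _ ≤ L * L := by gcongr
                _ = L ^ 2 := (sq L).symm
                _ = armProd i q p.2 * c ^ pulls p.2 t i := armProd_sq i g hqc p.2
                _ ≤ _ := by gcongr
            have h2 := (ENNReal.mul_le_mul_iff_left he0 het).1 h1
            exact h2.trans le_add_self
        · simp [Set.indicator_of_notMem hp]
    _ ≤ _ := by
        rw [lintegral_add_left (hind.const_mul _), lintegral_const_mul _ hind,
          lintegral_indicator_one hE]
        refine add_le_add le_rfl ?_
        exact lintegral_armProd_le A hqm hq1 t

end ChangeOfMeasure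

/-! ### Hard Gaussian instances -/

section Gaussian

theorem gaussianReal_eq_withDensity (m m' : ℝ) :
    gaussianReal m 1 = (gaussianReal m' 1).withDensity
      (fun x => ENNReal.ofReal (Real.exp ((m - m') * x - (m ^ 2 - m' ^ 2) / 2))) := by
  rw [gaussianReal_of_var_ne_zero _ one_ne_zero, gaussianReal_of_var_ne_zero _ one_ne_zero,
    ← withDensity_mul _ (measurable_gaussianPDF _ _) (by fun_prop)]
  congr 1
  funext x
  simp only [Pi.mul_apply, gaussianPDF]
  rw [← ENNReal.ofReal_mul (gaussianPDFReal_nonneg _ _ _)]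
  congr 1
  simp only [gaussianPDFReal, NNReal.coe_one, mul_one]
  rw [mul_assoc, ← Real.exp_add]
  congr 2
  ring

theorem lintegral_density_sq (m m' : ℝ) :
    ∫⁻ x, ENNReal.ofReal (Real.exp ((m - m') * x - (m ^ 2 - m' ^ 2) / 2)) ^ 2
      ∂gaussianReal m' 1 = ENNReal.ofReal (Real.exp ((m - m') ^ 2)) := by
  have h := congrFun (mgf_id_gaussianReal (μ := m') (v := 1)) (2 * (m - m'))
  simp only [mgf, id, NNReal.coe_one, one_mul] at h
  have e : ∀ x, ENNReal.ofReal (Real.exp ((m - m') * x - (m ^ 2 - m' ^ 2) / 2)) ^ 2 =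
      ENNReal.ofReal (Real.exp (-(m ^ 2 - m' ^ 2))) *
        ENNReal.ofReal (Real.exp (2 * (m - m') * x)) := by
    intro x
    rw [← ENNReal.ofReal_pow (Real.exp_pos _).le, ← ENNReal.ofReal_mul (Real.exp_pos _).le,
      ← Real.exp_add, ← Real.exp_nat_mul]
    congr 2
    push_cast
    ring
  simp_rw [e]
  rw [lintegral_const_mul _ (by fun_prop), ← ofReal_integral_eq_lintegral_ofReal
    (integrable_exp_mul_gaussianReal _) (ae_of_all _ fun _ => (Real.exp_pos _).le), h,
    ← ENNReal.ofReal_mul (Real.exp_pos _).le, ← Real.exp_add]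
  congr 2
  ring

variable {K : ℕ}

/-- The means `0, -1, -2, …` with the mean of arm `i` flipped to `i`. -/
def flippedMeans (i k : Fin K) : ℝ := if k = i then (i : ℝ) else -(k : ℝ)

/-- The Gaussian instance with means `flippedMeans i`. -/
noncomputable def flippedLaws (i k : Fin K) : Measure ℝ := gaussianReal (flippedMeans i k) 1

theorem means_flippedLaws (i : Fin K) : means (flippedLaws i) = flippedMeans i := by
  funext k
  simp [means, flippedLaws, integral_id_gaussianReal]

theorem bestArms_flippedMeans (i : Fin K) : bestArms (flippedMeans i) = {i} := by
  ext j
  rw [Finset.mem_singleton, bestArms, Finset.mem_filter]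
  constructor
  · rintro ⟨-, h⟩
    by_contra hne
    have := h i
    simp only [flippedMeans, if_true, hne, if_false] at this
    have h1 : (0 : ℝ) ≤ (j : ℕ) := Nat.cast_nonneg _
    have h2 : (0 : ℝ) ≤ (i : ℕ) := Nat.cast_nonneg _
    have h3 : ((j : ℕ) : ℝ) = 0 := by linarith
    have h4 : ((i : ℕ) : ℝ) = 0 := by linarith
    have h5 : (j : ℕ) = 0 := by exact_mod_cast h3
    have h6 : (i : ℕ) = 0 := by exact_mod_cast h4
    exact hne (Fin.ext (h5.trans h6.symm))
  · rintro rfl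
    refine ⟨Finset.mem_univ _, fun k => ?_⟩
    simp only [flippedMeans, if_true]
    have h1 : (0 : ℝ) ≤ (j : ℕ) := Nat.cast_nonneg _
    have h2 : (0 : ℝ) ≤ (k : ℕ) := Nat.cast_nonneg _
    split_ifs <;> linarith

theorem sum_one_div_sq_le {x : ℝ} (hx : 1 ≤ x) (n : ℕ) :
    ∑ k ∈ Finset.range (n + 1), 1 / (x + k) ^ 2 ≤ 2 / x - 1 / (x + n) := by
  induction n with
  | zero =>
    have : 1 / x ^ 2 ≤ 1 / x := one_div_le_one_div_of_le (by linarith) (by nlinarith)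
    have e : 2 / x = 1 / x + 1 / x := by ring
    simp only [zero_add, Finset.sum_range_one, Nat.cast_zero, add_zero]
    linarith
  | succ n ih =>
    rw [Finset.sum_range_succ]
    have h0 : (0 : ℝ) < x + n := by positivity
    have h1 : 1 / (x + (n + 1 : ℕ)) ^ 2 ≤ 1 / (x + n) - 1 / (x + (n + 1 : ℕ)) := by
      push_cast
      rw [div_sub_div _ _ h0.ne' (by positivity), div_le_div_iff₀ (by positivity) (by positivity)]
      nlinarith
    linarith

/-- After flipping arm `i` the gaps are `i + k`, so the risk is a tail of `∑ 1/x²` starting near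
`i`. Arm `0` satisfies the bound trivially. -/
theorem mul_riskH1_flippedMeans_le (i : Fin K) : (i : ℝ) * riskH1 (flippedMeans i) ≤ 2 := by
  have hb := bestArms_flippedMeans i
  rcases Nat.eq_zero_or_pos (i : ℕ) with h0 | h0
  · simp [h0]
  have hi : (1 : ℝ) ≤ (i : ℕ) := by exact_mod_cast h0
  have h1 : riskH1 (flippedMeans i) ≤ 2 / (i : ℕ) := by
    rw [riskH1_eq hb]
    have e : ∀ k ∈ Finset.univ.erase i, 1 / gap (flippedMeans i) k ^ 2 =
        1 / (((i : ℕ) : ℝ) + (k : ℕ)) ^ 2 := by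
      intro k hk
      rw [gap_eq hb]
      simp [flippedMeans, Finset.ne_of_mem_erase hk]
    rw [Finset.sum_congr rfl e]
    refine (Finset.sum_le_sum_of_subset_of_nonneg (Finset.erase_subset _ _)
      fun _ _ _ => by positivity).trans ?_
    rw [Fin.sum_univ_eq_sum_range (fun k => 1 / (((i : ℕ) : ℝ) + k) ^ 2) K]
    refine (Finset.sum_le_sum_of_subset_of_nonneg (Finset.range_mono (Nat.le_succ K))
      fun _ _ _ => by positivity).trans ?_
    have := sum_one_div_sq_le hi K
    have : 0 ≤ 1 / (((i : ℕ) : ℝ) + K) := by positivity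
    linarith
  calc ((i : ℕ) : ℝ) * riskH1 (flippedMeans i) ≤ (i : ℕ) * (2 / (i : ℕ)) := by gcongr
    _ = 2 := by field_simp

theorem log_le_sum_one_div [NeZero K] :
    Real.log K ≤ ∑ i ∈ Finset.univ.erase (0 : Fin K), 1 / ((i : ℕ) : ℝ) := by
  obtain ⟨n, hn⟩ : ∃ n, K = n + 1 := ⟨K - 1, by have := NeZero.pos K; omega⟩
  have h1 : ∑ i ∈ Finset.univ.erase (0 : Fin K), 1 / ((i : ℕ) : ℝ) =
      ∑ i : Fin K, 1 / ((i : ℕ) : ℝ) := by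
    rw [← Finset.add_sum_erase _ _ (Finset.mem_univ (0 : Fin K))]
    simp
  have h2 := log_add_one_le_harmonic n
  rw [h1, Fin.sum_univ_eq_sum_range (fun k => 1 / (k : ℝ)) K, hn, Finset.sum_range_succ']
  refine h2.trans (le_of_eq ?_)
  rw [harmonic]
  push_cast
  simp

theorem sum_pulls {t : ℕ} (h : Fin t → Fin K × ℝ) : ∑ i, pulls h t i = t := by
  unfold pulls
  rw [Finset.sum_comm]
  simp

/-- Pigeonhole with weights `1/i`: the expected pulls sum to `T`, so they cannot exceed the weighted
shares of `T` for all `i ≠ 0`. -/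
theorem exists_lintegral_pulls_le [NeZero K] {T : ℕ} (hK : 2 ≤ K) (A : Algorithm K T)
    (ν : Fin K → Measure ℝ) [∀ i, IsProbabilityMeasure (ν i)] :
    ∃ i : Fin K, i ≠ 0 ∧ ∫⁻ p, (pulls p.2 T i : ENNReal) ∂historyLaw A ν T ≤
      ENNReal.ofReal (T * (1 / ((i : ℕ) : ℝ)) /
        ∑ i ∈ Finset.univ.erase (0 : Fin K), 1 / ((i : ℕ) : ℝ)) := by
  have hP := isProbabilityMeasure_historyLaw A ν T
  have hm : ∀ i, Measurable fun p : A.Seed × (Fin T → Fin K × ℝ) => (pulls p.2 T i : ENNReal) :=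
    fun i => (measurable_from_top (f := fun n : ℕ => (n : ENNReal))).comp
      ((measurable_pulls T i).comp measurable_snd)
  set S := ∑ i ∈ Finset.univ.erase (0 : Fin K), 1 / ((i : ℕ) : ℝ) with hS
  have hS0 : 0 < S :=
    lt_of_lt_of_le (Real.log_pos (by exact_mod_cast hK)) log_le_sum_one_div
  have hsum : ∑ i, ∫⁻ p, (pulls p.2 T i : ENNReal) ∂historyLaw A ν T = T := by
    rw [← lintegral_finsetSum _ fun i _ => hm i]
    have : ∀ p : A.Seed × (Fin T → Fin K × ℝ), ∑ i, (pulls p.2 T i : ENNReal) = T := fun p => by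
      exact_mod_cast sum_pulls p.2
    simp [this]
  have hle : ∑ i ∈ Finset.univ.erase (0 : Fin K),
      ∫⁻ p, (pulls p.2 T i : ENNReal) ∂historyLaw A ν T ≤
      ∑ i ∈ Finset.univ.erase (0 : Fin K), ENNReal.ofReal (T * (1 / ((i : ℕ) : ℝ)) / S) := by
    refine (Finset.sum_le_sum_of_subset (Finset.erase_subset _ _)).trans ?_
    rw [hsum, ← ENNReal.ofReal_sum_of_nonneg fun i _ => by positivity, ← Finset.sum_div,
      ← Finset.mul_sum, ← hS, mul_div_cancel_right₀ _ hS0.ne', ENNReal.ofReal_natCast]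
  obtain ⟨j, hj⟩ := exists_ne_of_two_le hK 0
  by_contra! hcon
  refine absurd hle (not_le.2 ?_)
  exact ENNReal.sum_lt_sum_of_nonempty ⟨j, by simpa using hj⟩
    fun i hi => hcon i (Finset.ne_of_mem_erase hi)

/-- Every algorithm has a large probability of error on one of the flipped instances. -/
theorem exists_le_probError [NeZero K] (hK : 2 ≤ K) {T : ℕ} (hT : 0 < T) (A : Algorithm K T) :
    ∃ i : Fin K, ENNReal.ofReal (Real.exp (-(16 * ((i : ℕ) : ℝ) / Real.log K * T)) / 64) ≤
      probError A (flippedLaws i) := by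
  have hlog : 0 < Real.log K := Real.log_pos (by exact_mod_cast hK)
  have hinst : ∀ i k : Fin K, IsProbabilityMeasure (flippedLaws i k) := fun i k => by
    unfold flippedLaws; infer_instance
  have hP := isProbabilityMeasure_historyLaw A (flippedLaws (0 : Fin K)) T
  set P₀ := historyLaw A (flippedLaws (0 : Fin K)) T with hP₀
  have hrec : MeasurableSet {p | A.recommend p = (0 : Fin K)} :=
    A.measurable_recommend (measurableSet_singleton 0)
  have hbest : ∀ i : Fin K, bestArms (means (flippedLaws i)) = {i} := fun i => by
    rw [means_flippedLaws, bestArms_flippedMeans]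
  -- If the base instance itself already fails with probability one half, it serves as the witness;
  -- its exponent vanishes since `i = 0`.
  by_cases h0 : 1 / 2 ≤ P₀ {p | A.recommend p = (0 : Fin K)}ᶜ
  · refine ⟨0, ?_⟩
    have : probError A (flippedLaws (0 : Fin K)) = P₀ {p | A.recommend p = (0 : Fin K)}ᶜ := by
      unfold probError
      rw [hbest]
      congr 1
      ext p
      simp
    rw [this]
    refine le_trans ?_ h0
    rw [Fin.val_zero]
    simp only [Nat.cast_zero, mul_zero, zero_div, zero_mul, neg_zero, Real.exp_zero]
    refine ENNReal.ofReal_le_of_le_toReal ?_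
    norm_num
  have hrec0 : 1 / 2 ≤ P₀ {p | A.recommend p = (0 : Fin K)} := by
    have h1 := prob_add_prob_compl (μ := P₀) hrec
    by_contra hcon
    have := ENNReal.add_lt_add (not_le.1 hcon) (not_le.1 h0)
    rw [h1, ENNReal.add_halves] at this
    exact lt_irrefl _ this
  obtain ⟨i, hi, hpulls⟩ := exists_lintegral_pulls_le hK A (flippedLaws (0 : Fin K))
  refine ⟨i, ?_⟩
  set S := ∑ i ∈ Finset.univ.erase (0 : Fin K), 1 / ((i : ℕ) : ℝ) with hS
  have hSlog : Real.log K ≤ S := log_le_sum_one_div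
  have hS0 : 0 < S := hlog.trans_le hSlog
  have hi0 : (0 : ℝ) < (i : ℕ) := by
    have : (i : ℕ) ≠ 0 := fun h => hi (Fin.ext h)
    exact_mod_cast Nat.pos_of_ne_zero this
  -- Four times the mean bound, so that Markov leaves at most `1/4` for many pulls, and the event of
  -- few pulls and recommendation `0` keeps probability at least `1/4`.
  set n : ℝ := 4 * (T * (1 / ((i : ℕ) : ℝ)) / S) with hn
  have hT0 : (0 : ℝ) < T := by exact_mod_cast hT
  have hn0 : 0 < n := by positivity
  have hmp : Measurable fun p : A.Seed × (Fin T → Fin K × ℝ) => (pulls p.2 T i : ℝ) :=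
    (measurable_from_top (f := fun n : ℕ => (n : ℝ))).comp
      ((measurable_pulls T i).comp measurable_snd)
  have hfew : MeasurableSet {p : A.Seed × (Fin T → Fin K × ℝ) | (pulls p.2 T i : ℝ) ≤ n} :=
    measurableSet_le hmp measurable_const
  have hmany : P₀ {p | (pulls p.2 T i : ℝ) ≤ n}ᶜ ≤ 1 / 4 := by
    have h1 : P₀ {p | (pulls p.2 T i : ℝ) ≤ n}ᶜ ≤
        P₀ {p | ENNReal.ofReal n ≤ (pulls p.2 T i : ENNReal)} := by
      refine measure_mono fun p hp => ?_
      have hp : n < pulls p.2 T i := not_le.1 hp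
      change ENNReal.ofReal n ≤ (pulls p.2 T i : ENNReal)
      rw [← ENNReal.ofReal_natCast]
      exact ENNReal.ofReal_le_ofReal hp.le
    have h2 := mul_meas_ge_le_lintegral (μ := P₀)
      (f := fun p => (pulls p.2 T i : ENNReal))
      ((measurable_from_top (f := fun n : ℕ => (n : ENNReal))).comp
        ((measurable_pulls T i).comp measurable_snd)) (ENNReal.ofReal n)
    refine h1.trans ?_
    have h3 := h2.trans hpulls
    have hn' : T * (1 / ((i : ℕ) : ℝ)) / S = n * (1 / 4) := by rw [hn]; ring
    rw [hn', ENNReal.ofReal_mul hn0.le] at h3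
    have h4 := (ENNReal.mul_le_mul_iff_right (ENNReal.ofReal_pos.2 hn0).ne'
      ENNReal.ofReal_ne_top).1 h3
    refine h4.trans (le_of_eq ?_)
    rw [ENNReal.ofReal_div_of_pos (by norm_num)]
    norm_num
  set E := {p | A.recommend p = (0 : Fin K)} ∩ {p | (pulls p.2 T i : ℝ) ≤ n} with hE
  have hE4 : 1 / 4 ≤ P₀ E := by
    have h1 : P₀ {p | A.recommend p = (0 : Fin K)} ≤ P₀ E + 1 / 4 := by
      refine (measure_le_inter_add_sdiff P₀ _ {p | (pulls p.2 T i : ℝ) ≤ n}).trans ?_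
      gcongr
      exact (measure_mono fun p hp => hp.2).trans hmany
    have h2 : (1 / 4 : ENNReal) + 1 / 4 = 1 / 2 := by
      rw [ENNReal.div_add_div_same, ENNReal.div_eq_div_iff] <;> norm_num
    have h3 := hrec0.trans h1
    rw [← h2] at h3
    exact (ENNReal.add_le_add_iff_right (by simp)).1 h3
  have hmain := eight_mul_measure_le A (ν := flippedLaws (0 : Fin K)) (ν' := flippedLaws i)
    (i := i) (by fun_prop) (gaussianReal_eq_withDensity _ (flippedMeans i i))
    (fun j hj => by
      have : flippedMeans (0 : Fin K) j = flippedMeans i j := by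
        by_cases hj0 : j = 0
        · subst hj0; simp [flippedMeans, hj]
        · simp [flippedMeans, hj, hj0]
      rw [flippedLaws, this, flippedLaws])
    (sq_nonneg _) (lintegral_density_sq _ _).le T (hrec.inter hfew) (n := n) (fun p hp => hp.2)
  -- The mean moves by `2i`, so the exponent is `4i² · 4T / (iS)`, linear in `i`.
  have hd : (flippedMeans (0 : Fin K) i - flippedMeans i i) ^ 2 * n =
      16 * ((i : ℕ) : ℝ) / S * T := by
    simp only [flippedMeans, hi, if_false, if_true, hn]
    field_simp
    ring
  rw [hd] at hmain
  have herr : historyLaw A (flippedLaws i) T E ≤ probError A (flippedLaws i) := by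
    refine measure_mono fun p hp => ?_
    have hp : A.recommend p = 0 := hp.1
    simp only [Set.mem_ofPred_eq, hbest, hp, Finset.mem_singleton]
    exact hi.symm
  refine le_trans ?_ herr
  set y := 16 * ((i : ℕ) : ℝ) / S * T with hy
  have hyle : y ≤ 16 * ((i : ℕ) : ℝ) / Real.log K * T := by
    rw [hy]
    gcongr
  -- Since `8 · 1/4 = 2`, the additive error 1 of the change of measure can be cancelled.
  have h1 : (1 : ENNReal) + 1 ≤
      64 * ENNReal.ofReal (Real.exp y) * historyLaw A (flippedLaws i) T E + 1 := by
    refine le_trans ?_ hmain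
    calc (1 : ENNReal) + 1 = 8 * (1 / 4) := by
          rw [one_div, ← div_eq_mul_inv, ENNReal.eq_div_iff] <;> norm_num
      _ ≤ _ := by gcongr
  have h2 := (ENNReal.add_le_add_iff_right ENNReal.one_ne_top).1 h1
  have h3 : (64 : ENNReal) * ENNReal.ofReal (Real.exp y) = ENNReal.ofReal (64 * Real.exp y) := by
    rw [ENNReal.ofReal_mul (by norm_num)]
    norm_num
  rw [h3] at h2
  have h4 : ENNReal.ofReal (Real.exp (-y) / 64) ≤ historyLaw A (flippedLaws i) T E := by
    have e : Real.exp (-y) / 64 = (64 * Real.exp y)⁻¹ := by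
      rw [Real.exp_neg, mul_inv]; ring
    rw [e, ENNReal.ofReal_inv_of_pos (by positivity), ENNReal.inv_le_iff_le_mul]
    · exact h2
    · intro _; exact (ENNReal.ofReal_pos.2 (by positivity)).ne'
    · intro h; exact absurd h ENNReal.ofReal_ne_top
  refine le_trans (ENNReal.ofReal_le_ofReal ?_) h4
  gcongr

theorem rate_le [NeZero K] (hK : 2 ≤ K) {D : Set (Measure ℝ)} (hD : gaussianLaws ⊆ D)
    (A : (T : ℕ) → Algorithm K T) : rate riskH1 D A ≤ ((32 / Real.log K : ℝ) : EReal) := by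
  have hlog : 0 < Real.log K := Real.log_pos (by exact_mod_cast hK)
  -- The bad arm may vary with `T`, but there are finitely many arms, so one of them is bad for
  -- infinitely many budgets. This suffices because the rate uses a `liminf`.
  obtain ⟨i, hi⟩ : ∃ i : Fin K, ∃ᶠ T : ℕ in atTop, 0 < T ∧
      ENNReal.ofReal (Real.exp (-(16 * ((i : ℕ) : ℝ) / Real.log K * T)) / 64) ≤
        probError (A T) (flippedLaws i) := by
    by_contra hcon
    push Not at hcon
    have h := eventually_all.2 hcon
    obtain ⟨T, h1, h2⟩ := (h.and (eventually_gt_atTop 0)).exists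
    obtain ⟨i, hi⟩ := exists_le_probError hK h2 (A T)
    exact (h1 i h2).not_ge hi
  set c : ℝ := 16 * ((i : ℕ) : ℝ) / Real.log K with hc
  have hbest : bestArms (means (flippedLaws i)) = {i} := by
    rw [means_flippedLaws, bestArms_flippedMeans]
  have hlim : liminf (fun T : ℕ => ENNReal.log (probError (A T) (flippedLaws i))⁻¹ / (T : EReal))
      atTop ≤ (c : EReal) := by
    refine EReal.le_of_forall_lt_iff_le.1 fun z hz => ?_
    have hz : c < z := by exact_mod_cast hz
    refine liminf_le_of_frequently_le' ?_
    have hev : ∀ᶠ T : ℕ in atTop, Real.log 64 / (z - c) ≤ T :=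
      tendsto_natCast_atTop_atTop.eventually_ge_atTop _
    refine (hi.and_eventually hev).mono fun T ⟨⟨hT, h1⟩, h2⟩ => ?_
    have hT0 : (0 : ℝ) < T := by exact_mod_cast hT
    rw [div_le_iff₀ (by linarith)] at h2
    have h3 : (probError (A T) (flippedLaws i))⁻¹ ≤ ENNReal.ofReal (Real.exp (z * T)) := by
      rw [ENNReal.inv_le_iff_inv_le, ← ENNReal.ofReal_inv_of_pos (Real.exp_pos _)]
      refine le_trans (ENNReal.ofReal_le_ofReal ?_) h1
      have e64 : (64 : ℝ) = Real.exp (Real.log 64) := (Real.exp_log (by norm_num)).symm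
      rw [← Real.exp_neg, e64, ← Real.exp_sub]
      refine Real.exp_le_exp.2 ?_
      nlinarith
    have h4 := ENNReal.log_monotone h3
    rw [ENNReal.log_ofReal_of_pos (Real.exp_pos _), Real.log_exp] at h4
    calc _ ≤ ((z * T : ℝ) : EReal) / (T : EReal) :=
          EReal.div_le_div_right_of_nonneg (by positivity) h4
      _ = ((z * T / T : ℝ) : EReal) := by rw [EReal.coe_div]; rfl
      _ = z := by rw [mul_div_cancel_right₀ _ hT0.ne']
  unfold rate
  refine iInf_le_of_le (flippedLaws i) (iInf_le_of_le (fun k => hD ⟨_, rfl⟩)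
    (iInf_le_of_le (by rw [hbest, Finset.card_singleton]) ?_))
  have hH := riskH1_pos hK hbest
  calc _ ≤ (riskH1 (means (flippedLaws i)) : EReal) * (c : EReal) := by
        have : (0 : EReal) ≤ riskH1 (means (flippedLaws i)) := by exact_mod_cast hH.le
        gcongr
    _ = ((riskH1 (means (flippedLaws i)) * c : ℝ) : EReal) := (EReal.coe_mul _ _).symm
    _ ≤ _ := by
        rw [EReal.coe_le_coe_iff, hc, mul_div_assoc']
        gcongr
        rw [means_flippedLaws]
        have := mul_riskH1_flippedMeans_le i
        linarith

end Gaussian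

end BAI

/-! ### Combination of the two bounds. -/

open BAI in
theorem mainTheorem1 :
    ∃ C c₁ c₂ : ℝ, 0 < C ∧ 0 < c₁ ∧ 0 < c₂ ∧
      ∀ D : Set (Measure ℝ), gaussianLaws ⊆ D → D ⊆ subGaussianLaws →
      ∀ (K : ℕ) [NeZero K], 2 ≤ K →
        (∀ A : (T : ℕ) → Algorithm K T,
          rate riskH1 D A ≤ ((c₂ / Real.log K : ℝ) : EReal)) ∧
        ∀ Csuf : ℝ, 0 < Csuf → Csuf < 1 →
        ∀ N : ℕ → ℕ,
          (fun _ : ℕ => (K : ℝ)) =o[atTop] (fun T : ℕ => (N T : ℝ)) →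
          (fun T : ℕ => (N T : ℝ) * K * Real.log K) =o[atTop] (fun T : ℕ => (T : ℝ)) →
          (∀ A : (T : ℕ) → Algorithm K T,
            (C : EReal) * rate riskH1 D A ≤
              rate riskH1 D
                (fun T => almostTracking (K := K) allocation measurable_allocation Csuf (N T) T)) ∧
          ((c₁ / Real.log K : ℝ) : EReal) ≤
            rate riskH1 D
              (fun T => almostTracking (K := K) allocation measurable_allocation Csuf (N T) T) := by
  refine ⟨1 / 196608 / 32, 1 / 196608, 32, by norm_num, by norm_num, by norm_num, ?_⟩
  intro D hD₁ hD₂ K _ hK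
  refine ⟨fun A => rate_le hK hD₁ A, fun Csuf hC0 hC1 N hN hNT => ?_⟩
  have hlog : 0 < Real.log K := Real.log_pos (by exact_mod_cast hK)
  have hK0 : (K : ℝ) ≠ 0 := by positivity
  have hN' : Tendsto (fun T => (N T : ℝ)) atTop atTop := by
    have := (isLittleO_const_left.1 hN).resolve_left hK0
    simpa [Function.comp_def] using this
  -- With `K` fixed, the factor `K log K` is a nonzero constant, so the growth condition reduces to
  -- `N / T → 0`.
  have hNT' : Tendsto (fun T => (N T : ℝ) / T) atTop (nhds 0) := by
    have := hNT.tendsto_div_nhds_zero.mul_const (1 / (K * Real.log K))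
    rw [zero_mul] at this
    refine this.congr fun T => ?_
    field_simp
  have hrate := le_rate_almostTracking hK hD₂ hC0 hC1 hN' hNT'
  refine ⟨fun A => le_trans ?_ hrate, hrate⟩
  have hC : (0 : EReal) ≤ ((1 / 196608 / 32 : ℝ) : EReal) := by
    rw [← EReal.coe_zero, EReal.coe_le_coe_iff]
    norm_num
  refine (mul_le_mul_of_nonneg_left (rate_le hK hD₁ A) hC).trans (le_of_eq ?_)
  rw [← EReal.coe_mul]
  congr 1
  field_simp
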